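/- Let $F$ be a global field, that is, a finite extension of $\mathbb{Q}$ or of $\mathbb{F}_p(t)$ for a prime $p$. Let $S$ be a finite set of places of $F$ (equivalence classes of nontrivial absolute values) containing all infinite (that is, archimedean) places. For an absolute value $|\cdot|_v$ and points $P=[x_1:y_1]$, $Q=[x_2:y_2]$ of $\mathbb{P}^1(F)$ put $$\delta_v(P,Q)=\frac{|x_1y_2-x_2y_1|_v}{\max\{|x_1|_v,|y_1|_v\}\,\max\{|x_2|_v,|y_2|_v\}},$$ and call $P$ $S$-integral to $Q$ if $\delta_v(P,Q)=1$ for every place $v\notin S$. Let $\varphi\in F(x)$ be a rational function of degree at least $2$, regarded as a self-map of $\mathbb{P}^1$, and let $\alpha,\beta\in\mathbb{P}^1(F)$. Suppose that $\beta$ is periodic, i.e. $\varphi^n(\beta)=\beta$ for some $n\ge 1$, and not exceptional, i.e. its back orbit $\{\gamma\in\mathbb{P}^1(\overline{F}) : \varphi^n(\gamma)=\beta \text{ for some } n\ge 1\}$ is infinite. Then only finitely many elements of the forward orbit $\mathcal{O}_\varphi(\alpha)=\{\alpha,\varphi(\alpha),\varphi^2(\alpha),\dots\}$ are $S$-integral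 to $\beta$. -/

import Mathlib

namespace ArithDyn

open scoped Polynomial

universe u

/-- A global field: a finite extension of `ℚ` or of `𝔽_p(t)` for some prime `p`. -/
def IsGlobalField (F : Type u) [Field F] : Prop :=
  NumberField F ∨
    ∃ (p : ℕ) (_ : Fact p.Prime) (_ : Algebra (RatFunc (ZMod p)) F),
      FiniteDimensional (RatFunc (ZMod p)) F

/-- Equivalence of nontrivial absolute values. -/
def placeSetoid (F : Type u) [Field F] :
    Setoid {v : AbsoluteValue F ℝ // v.IsNontrivial} where
  r v w := v.1.IsEquiv w.1
  iseqv := ⟨fun _ => .rfl, fun h => h.symm, fun h₁ h₂ => h₁.trans h₂⟩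

/-- The places of `F`: equivalence classes of nontrivial absolute values. -/
def Place (F : Type u) [Field F] : Type u := Quotient (placeSetoid F)

/-- The place of a nontrivial absolute value. -/
def Place.mk {F : Type u} [Field F] (v : AbsoluteValue F ℝ) (hv : v.IsNontrivial) : Place F :=
  Quotient.mk (placeSetoid F) ⟨v, hv⟩

/-- A place is infinite if it is the class of an archimedean absolute value. -/
def Place.IsInfinite {F : Type u} [Field F] (w : Place F) : Prop :=
  ∃ (v : AbsoluteValue F ℝ) (hv : v.IsNontrivial), Place.mk v hv = w ∧ ¬ IsNonarchimedean v

/-- Homogeneous coordinates on `ℙ¹(K) = K ∪ {∞}`: `x = [x : 1]` and `∞ = [1 : 0]`. -/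
def coords {K : Type u} [Field K] (P : OnePoint K) : K × K :=
  OnePoint.elim P (1, 0) (fun x => (x, 1))

/-- The chordal metric on `ℙ¹(K)` attached to an absolute value of `K`. -/
noncomputable def chordal {K : Type u} [Field K] (v : AbsoluteValue K ℝ) (P Q : OnePoint K) : ℝ :=
  v ((coords P).1 * (coords Q).2 - (coords Q).1 * (coords P).2) /
    (max (v (coords P).1) (v (coords P).2) * max (v (coords Q).1) (v (coords Q).2))

/-- `P` is `S`-integral to `Q`: `δ_v(P, Q) = 1` for all places `v` outside `S`. Whether
`δ_v(P, Q) = 1` depends only on the place of `v`, see `chordal_eq_one_congr`. -/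
def IsSIntegralTo {F : Type u} [Field F] (S : Finset (Place F)) (P Q : OnePoint F) : Prop :=
  ∀ (v : AbsoluteValue F ℝ) (hv : v.IsNontrivial), Place.mk v hv ∉ S → chordal v P Q = 1

/-- The degree of a rational function, that is, of the map that it induces on `ℙ¹`. -/
noncomputable def ratDegree {F : Type u} [Field F] (φ : RatFunc F) : ℕ :=
  max φ.num.natDegree φ.denom.natDegree

open scoped Classical in
/-- The self-map of `ℙ¹(L) = L ∪ {∞}` induced by a rational function `φ = f / g` over `F`, where
`f`, `g` are coprime polynomials and `L` is an extension field of `F`. -/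
noncomputable def ratMap {F : Type u} [Field F] (φ : RatFunc F) (L : Type u) [Field L]
    [Algebra F L] (P : OnePoint L) : OnePoint L :=
  OnePoint.elim P
    (if φ.denom.natDegree < φ.num.natDegree then OnePoint.infty
      else ((algebraMap F L (φ.num.coeff φ.denom.natDegree / φ.denom.leadingCoeff) : L) :
        OnePoint L))
    (fun x => if Polynomial.aeval x φ.denom = 0 then OnePoint.infty
      else ((Polynomial.aeval x φ.num / Polynomial.aeval x φ.denom : L) : OnePoint L))

/-- The forward orbit `{P, φ(P), φ²(P), …}` of a point of `ℙ¹(F)`. -/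
def forwardOrbit {F : Type u} [Field F] (φ : RatFunc F) (P : OnePoint F) : Set (OnePoint F) :=
  {Q | ∃ n : ℕ, Q = (ratMap φ F)^[n] P}

/-- The back orbit of `P ∈ ℙ¹(F)`: the points of `ℙ¹` over the algebraic closure that are mapped
to `P` by some iterate `φⁿ`, `n ≥ 1`. -/
def backOrbit {F : Type u} [Field F] (φ : RatFunc F) (P : OnePoint F) :
    Set (OnePoint (AlgebraicClosure F)) :=
  {Q | ∃ n : ℕ, 1 ≤ n ∧
    (ratMap φ (AlgebraicClosure F))^[n] Q = OnePoint.map (algebraMap F (AlgebraicClosure F)) P}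

/-- A point is exceptional if its back orbit is finite. -/
def IsExceptional {F : Type u} [Field F] (φ : RatFunc F) (P : OnePoint F) : Prop :=
  (backOrbit φ P).Finite

/-- A point is periodic if `φⁿ(P) = P` for some `n ≥ 1`. -/
def IsPeriodic {F : Type u} [Field F] (φ : RatFunc F) (P : OnePoint F) : Prop :=
  ∃ n : ℕ, 1 ≤ n ∧ (ratMap φ F)^[n] P = P

theorem chordal_eq_one_congr {F : Type u} [Field F] {v w : AbsoluteValue F ℝ}
    (h : v.IsEquiv w) (P Q : OnePoint F) : chordal v P Q = 1 ↔ chordal w P Q = 1 := by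
  have key : ∀ u : AbsoluteValue F ℝ, ∀ P : OnePoint F,
      ∃ a : F, a ≠ 0 ∧ max (u (coords P).1) (u (coords P).2) = u a ∧
        (a = (coords P).1 ∨ a = (coords P).2) := by
    intro u P
    induction P using OnePoint.rec with
    | infty => exact ⟨1, one_ne_zero, by simp [coords], by simp [coords]⟩
    | coe x =>
      rcases le_total (u x) 1 with hx | hx
      · exact ⟨1, one_ne_zero, by simp [coords, hx], by simp [coords]⟩
      · refine ⟨x, ?_, by simp [coords, hx], by simp [coords]⟩
        rintro rfl
        simp at hx
        linarith
  have hmax : ∀ P : OnePoint F, ∃ a : F, a ≠ 0 ∧ max (v (coords P).1) (v (coords P).2) = v a ∧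
      max (w (coords P).1) (w (coords P).2) = w a := by
    intro P
    obtain ⟨a, ha, hva, hor⟩ := key v P
    refine ⟨a, ha, hva, ?_⟩
    have h1 : w (coords P).1 ≤ w a := (h _ _).1 (hva ▸ le_max_left _ _)
    have h2 : w (coords P).2 ≤ w a := (h _ _).1 (hva ▸ le_max_right _ _)
    refine le_antisymm (max_le h1 h2) ?_
    rcases hor with e | e
    · exact e ▸ le_max_left _ _
    · exact e ▸ le_max_right _ _
  obtain ⟨a, ha, hva, hwa⟩ := hmax P
  obtain ⟨b, hb, hvb, hwb⟩ := hmax Q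
  unfold chordal
  rw [hva, hvb, hwa, hwb, ← map_mul, ← map_mul, div_eq_one_iff_eq (by simp [ha, hb]),
    div_eq_one_iff_eq (by simp [ha, hb]), h.eq_iff_eq]

end ArithDyn

/-!
Replacing `φ` by an iterate, one may assume that `β` is fixed, and a change of coordinates moves
it to infinity (`exists_polynomial_model`). The dynamical system is then `x ↦ f(x) / g(x)` with
coprime `f`, `g` and `deg g < deg f = d`; that `β` is not exceptional means that `g` is not
constant, that is, that infinity is not totally ramified. Let `x₀, x₁, …` be an infinite orbit that
is infinitely often integral outside of a finite set of places, which may be enlarged so that the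
map has good reduction outside of it. As infinity is fixed, integrality propagates backwards along the
orbit, so all `xₙ` are integral and all `g(xₙ)` are units outside of the finite set.

Put `D_v(n) = log max(1, |xₙ|_v)` for the finitely many remaining `v`, and let `H(n)` be their sum.
By the product formula for `g(xₙ)`, we have `H(n + 1) ≥ d H(n) - C`, and `H` is unbounded by
Northcott's theorem. On the other hand, if `xₙ` is `v`-adically close to infinity, then so is
`xₙ₊₁`, and `D_v(n + 1) ≤ (d - 1) D_v(n) + C`, because infinity is not totally ramified
(`exists_logSize_bounds`). So once an orbit point has come close to infinity at `v`, the next ones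
stay close for a very long time, during which `D_v` grows more slowly than `H`. There are only
finitely many `v` at which this can happen for the first time, and afterwards nothing makes up for
the growth of `H` (`growth_contradiction`). No Diophantine approximation is needed.

Global fields enter through the notion of a `PlaceSystem` on the base field `K`, which is `ℚ` or
`𝔽_p(t)`: absolute values with product formula and Northcott property, each extended to an
algebraically closed field. On a finite separable extension of `K`, the absolute values are obtained
from the `K`-embeddings into these closed fields, and the product formula follows from the
description of the norm as a product over embeddings. An inseparable extension `F` of `K` is mapped
into the separable closure of `K` in `F` by a power of Frobenius, which multiplies the logarithms
of absolute values by a constant and does no harm.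
-/

open scoped Polynomial

namespace ArithDyn

universe u

/-! ### Absolute values on the base fields -/

/-- An algebraically closed field with an absolute value extending a given one `v` on `K`. -/
structure ClosedExtension {K : Type} [Field K] (v : AbsoluteValue K ℝ) where
  carrier : Type
  [field : Field carrier]
  [algebra : Algebra K carrier]
  [isAlgClosed : IsAlgClosed carrier]
  abs : AbsoluteValue carrier ℝ
  isNonarchimedean : IsNonarchimedean v → IsNonarchimedean abs
  abs_algebraMap : ∀ x, abs (algebraMap K carrier x) = v x

attribute [instance] ClosedExtension.field ClosedExtension.algebra ClosedExtension.isAlgClosed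

/-- A nontrivial nonarchimedean absolute value on a field extends to some algebraically closed
extension: complete, pass to an algebraic closure and take the spectral norm. -/
theorem nonempty_closedExtension {K : Type} [Field K] (v : AbsoluteValue K ℝ)
    (hna : IsNonarchimedean v) (hnt : v.IsNontrivial) : Nonempty (ClosedExtension v) := by
  let K' := v.Completion
  let j : K →+* K' := (UniformSpace.Completion.coeRingHom (α := WithAbs v)).comp
    (WithAbs.equiv v).symm.toRingHom
  have hj : ∀ x, ‖j x‖ = v x := by
    intro x
    change ‖((WithAbs.toAbs v x : WithAbs v) : K')‖ = v x
    rw [UniformSpace.Completion.norm_coe]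
    rfl
  have hult : IsUltrametricDist K' := by
    refine IsUltrametricDist.isUltrametricDist_of_isNonarchimedean_norm ?_
    intro x y
    induction x, y using UniformSpace.Completion.induction_on₂ with
    | hp => exact isClosed_le (by fun_prop) (by fun_prop)
    | ih a b =>
      rw [← UniformSpace.Completion.coe_add, UniformSpace.Completion.norm_coe,
        UniformSpace.Completion.norm_coe, UniformSpace.Completion.norm_coe]
      exact hna _ _
  let _ : NontriviallyNormedField K' :=
    { (inferInstance : NormedField K') with
      non_trivial := by
        obtain ⟨x, hx⟩ := hnt.exists_abv_gt_one
        exact ⟨j x, by rw [hj]; exact hx⟩ }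
  let L := AlgebraicClosure K'
  let _ : NormedField L := spectralNorm.normedField K' L
  let _ : Algebra K L := ((algebraMap K' L).comp j).toAlgebra
  refine ⟨⟨L, NormedField.toAbsoluteValue L, ?_, ?_⟩⟩
  · intro _ x y
    exact isNonarchimedean_spectralNorm (K := K') (L := L) x y
  · intro x
    change spectralNorm K' L (algebraMap K' L (j x)) = v x
    rw [spectralNorm_extends, hj]

/-- A family of absolute values on `K` that satisfies the product formula and Northcott's
finiteness property, is nonarchimedean and pairwise inequivalent away from one index `infty`, and
whose members extend to algebraically closed fields. -/
structure PlaceSystem (K : Type) [Field K] where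
  ι : Type
  abs : ι → AbsoluteValue K ℝ
  ext : ∀ i, ClosedExtension (abs i)
  infty : ι
  isNonarchimedean : ∀ i ≠ infty, IsNonarchimedean (abs i)
  exists_uniformizer : ∀ i ≠ infty, ∃ a : K, a ≠ 0 ∧ abs i a < 1 ∧
    ∀ j ≠ infty, j ≠ i → abs j a = 1
  finite_abs_ne_one : ∀ a : K, a ≠ 0 → {i | abs i a ≠ 1}.Finite
  finprod_abs : ∀ a : K, a ≠ 0 → ∏ᶠ i, abs i a = 1
  northcott : ∀ (T : Finset ι) (B : ℝ),
    {a : K | (∀ i ∉ T, abs i a ≤ 1) ∧ ∀ i ∈ T, abs i a ≤ B}.Finite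

section PrincipalIdealDomain

open IsDedekindDomain

variable {R : Type} [CommRing R] [IsPrincipalIdealRing R]

theorem HeightOneSpectrum.generator_spec [IsDomain R] (v : HeightOneSpectrum R) :
    ∃ r : R, Prime r ∧ v.asIdeal = Ideal.span {r} := by
  refine ⟨Submodule.IsPrincipal.generator v.asIdeal,
    Submodule.IsPrincipal.prime_generator_of_isPrime _ v.ne_bot, ?_⟩
  exact (Ideal.span_singleton_generator _).symm

/-- The place system of the fraction field of a principal ideal domain: the place `infty` is
given, and a prime `r` gets the `r`-adic absolute value normalized by `|r|_r = |r|_infty⁻¹`, which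
makes the product formula hold. -/
theorem nonempty_placeSystem [IsDomain R] {K : Type} [Field K] [Algebra R K]
    [IsFractionRing R K] (w : AbsoluteValue K ℝ) (hw : Nonempty (ClosedExtension w))
    (hprime : ∀ r : R, Prime r → 1 < w (algebraMap R K r))
    (hunit : ∀ r : R, IsUnit r → w (algebraMap R K r) = 1)
    (hfin : ∀ B : ℝ, {r : R | w (algebraMap R K r) ≤ B}.Finite) :
    Nonempty (PlaceSystem K) := by
  classical
  choose gen hgen_prime hgen using (HeightOneSpectrum.generator_spec (R := R))
  have hb : ∀ v, 1 < (w (algebraMap R K (gen v))).toNNReal :=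
    fun v => Real.one_lt_toNNReal.2 (hprime _ (hgen_prime v))
  let abs : Option (HeightOneSpectrum R) → AbsoluteValue K ℝ :=
    fun i => i.elim w (fun v => v.adicAbv (hb v))
  have hmem : ∀ (v : HeightOneSpectrum R) (r : R), Prime r →
      (r ∈ v.asIdeal ↔ Associated (gen v) r) := by
    intro v r hr
    rw [hgen, Ideal.mem_span_singleton]
    exact ⟨fun h => (hgen_prime v).associated_of_dvd hr h, fun h => h.dvd⟩
  have hone : ∀ (v : HeightOneSpectrum R) (r : R), r ∉ v.asIdeal →
      abs (some v) (algebraMap R K r) = 1 :=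
    fun v r h => (v.adicAbv_coe_eq_one_iff (hb v) r).2 h
  have hle : ∀ (v : HeightOneSpectrum R) (r : R), abs (some v) (algebraMap R K r) ≤ 1 :=
    fun v r => v.adicAbv_coe_le_one (hb v) r
  have hdiff : ∀ v v' : HeightOneSpectrum R, Associated (gen v) (gen v') → v = v' := by
    intro v v' h
    ext1
    rw [hgen, hgen, Ideal.span_singleton_eq_span_singleton.2 h]
  -- the product formula, on `R`
  have hR : ∀ r : R, r ≠ 0 → {i | abs i (algebraMap R K r) ≠ 1}.Finite ∧
      ∏ᶠ i, abs i (algebraMap R K r) = 1 := by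
    intro r hr
    induction r using UniqueFactorizationMonoid.induction_on_prime with
    | h₁ => exact absurd rfl hr
    | h₂ u hu =>
      have : ∀ i, abs i (algebraMap R K u) = 1 := by
        rintro (_ | v)
        · exact hunit _ hu
        · exact hone v u fun h => v.isPrime.ne_top (Ideal.eq_top_of_isUnit_mem _ h hu)
      simp [this]
    | h₃ a p ha hp ih =>
      obtain ⟨ih1, ih2⟩ := ih ha
      let v₀ : HeightOneSpectrum R := ⟨Ideal.span {p},
        (Ideal.span_singleton_prime hp.ne_zero).2 hp, by simpa using hp.ne_zero⟩
      have hv₀ : Associated (gen v₀) p := (hmem v₀ p hp).1 (Ideal.mem_span_singleton_self p)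
      have h1 : ∀ v, v ≠ v₀ → abs (some v) (algebraMap R K p) = 1 := by
        intro v hv
        refine hone v p fun h => hv ?_
        exact hdiff _ _ (((hmem v p hp).1 h).trans hv₀.symm)
      have hgp : w (algebraMap R K (gen v₀)) = w (algebraMap R K p) := by
        obtain ⟨u, hu⟩ := hv₀
        rw [← hu, map_mul, map_mul, hunit _ u.isUnit, mul_one]
      have h2 : abs (some v₀) (algebraMap R K p) = (w (algebraMap R K p))⁻¹ := by
        change v₀.adicAbv (hb v₀) (algebraMap R K p) = _
        rw [HeightOneSpectrum.adicAbv_of_algebraMap, ← hgp]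
        simp [HeightOneSpectrum.intAdicAbv, HeightOneSpectrum.intAdicAbvDef,
          v₀.intValuation_singleton hp.ne_zero rfl]
        rw [WithZeroMulInt.toNNReal_neg_apply _ WithZero.exp_ne_zero]
        change (((w (algebraMap R K (gen v₀))).toNNReal ^ (1 : ℤ) : NNReal) : ℝ) = _
        simp
      have hsub : {i | abs i (algebraMap R K p) ≠ 1} ⊆ ({none, some v₀} : Finset _) := by
        rintro (_ | v) hi
        · simp
        · by_cases hv : v = v₀
          · simp [hv]
          · exact absurd (h1 v hv) hi
      have hfinp : {i | abs i (algebraMap R K p) ≠ 1}.Finite := (Finset.finite_toSet _).subset hsub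
      constructor
      · refine (hfinp.union ih1).subset fun i hi => ?_
        by_contra hcon
        simp only [Set.mem_union, Set.mem_ofPred_eq, not_or, not_not] at hcon
        exact hi (by rw [map_mul, map_mul, hcon.1, hcon.2, one_mul])
      · simp only [map_mul]
        rw [finprod_mul_distrib hfinp ih1, ih2, mul_one,
          finprod_eq_prod_of_mulSupport_subset _ hsub,
          Finset.prod_pair (by simp), h2]
        exact mul_inv_cancel₀ (zero_lt_one.trans (hprime p hp)).ne'
  have hK : ∀ a : K, a ≠ 0 → {i | abs i a ≠ 1}.Finite ∧ ∏ᶠ i, abs i a = 1 := by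
    intro a ha
    obtain ⟨r, s, hs, rfl⟩ := IsFractionRing.div_surjective (A := R) a
    have hs0 : s ≠ 0 := nonZeroDivisors.ne_zero hs
    have hr0 : r ≠ 0 := by rintro rfl; simp at ha
    obtain ⟨hr1, hr2⟩ := hR r hr0
    obtain ⟨hs1, hs2⟩ := hR s hs0
    constructor
    · refine (hr1.union hs1).subset fun i hi => ?_
      by_contra hcon
      simp only [Set.mem_union, Set.mem_ofPred_eq, not_or, not_not] at hcon
      exact hi (by rw [map_div₀, hcon.1, hcon.2, div_one])
    · simp only [map_div₀]
      rw [finprod_div_distrib hr1 hs1, hr2, hs2, div_one]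
  have hna : ∀ i ≠ none, IsNonarchimedean (abs i) := by
    rintro (_ | v) hi
    · exact absurd rfl hi
    · exact v.isNonarchimedean_adicAbv (hb v)
  have hunif : ∀ i ≠ none, ∃ a : K, a ≠ 0 ∧ abs i a < 1 ∧
      ∀ j ≠ none, j ≠ i → abs j a = 1 := by
    rintro (_ | v) hi
    · exact absurd rfl hi
    · refine ⟨algebraMap R K (gen v), ?_, ?_, ?_⟩
      · simpa using (hgen_prime v).ne_zero
      · exact (v.adicAbv_coe_lt_one_iff (hb v) _).2
          ((hmem v _ (hgen_prime v)).2 (Associated.refl _))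
      · rintro (_ | v') hj hjv
        · exact absurd rfl hj
        · refine hone v' _ fun h => hjv ?_
          rw [hdiff v' v ((hmem v' _ (hgen_prime v)).1 h)]
  have hext : ∀ i, Nonempty (ClosedExtension (abs i)) := by
    rintro (_ | v)
    · exact hw
    · refine nonempty_closedExtension _ (hna (some v) (by simp)) ?_
      obtain ⟨a, ha, h1, -⟩ := hunif (some v) (by simp)
      exact ⟨a, ha, h1.ne⟩
  refine ⟨⟨_, abs, fun i => (hext i).some, none, hna, hunif, fun a ha => (hK a ha).1,
    fun a ha => (hK a ha).2, fun T B => ?_⟩⟩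
  -- a common denominator for all elements in question
  obtain ⟨N, hN0, hN⟩ : ∃ N : R, N ≠ 0 ∧
      ∀ v, some v ∈ T → abs (some v) (algebraMap R K N) * B ≤ 1 := by
    clear hR hK hext
    induction T using Finset.induction_on with
    | empty => exact ⟨1, one_ne_zero, by simp⟩
    | insert i T _ ih =>
      obtain ⟨N, hN0, hN⟩ := ih
      have key : ∀ M : R, ∀ v, some v ∈ T → abs (some v) (algebraMap R K (M * N)) * B ≤ 1 := by
        intro M v hv
        rcases le_total B 0 with hB | hB
        · exact (mul_nonpos_of_nonneg_of_nonpos (by positivity) hB).trans zero_le_one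
        · rw [map_mul, map_mul, mul_assoc]
          exact mul_le_one₀ (hle v M) (by positivity) (hN v hv)
      rcases i with _ | v₀
      · exact ⟨N, hN0, fun v hv => by simpa using key 1 v (by simpa using hv)⟩
      have h1 : abs (some v₀) (algebraMap R K (gen v₀)) < 1 :=
        (v₀.adicAbv_coe_lt_one_iff (hb v₀) _).2 ((hmem v₀ _ (hgen_prime v₀)).2 (Associated.refl _))
      obtain ⟨k, hk⟩ := exists_pow_lt_of_lt_one
        (show (0 : ℝ) < 1 / max B 1 by positivity) h1
      refine ⟨gen v₀ ^ k * N, mul_ne_zero (pow_ne_zero _ (hgen_prime v₀).ne_zero) hN0, ?_⟩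
      intro v hv
      rcases Finset.mem_insert.1 hv with hv | hv
      · obtain rfl : v = v₀ := by simpa using hv
        rw [lt_div_iff₀ (by positivity)] at hk
        rw [map_mul, map_mul, map_pow, map_pow]
        calc _ ≤ abs (some v) (algebraMap R K (gen v)) ^ k * abs (some v) (algebraMap R K N) *
              max B 1 := by
              gcongr
              exact le_max_left _ _
          _ ≤ abs (some v) (algebraMap R K (gen v)) ^ k * 1 * max B 1 := by
              gcongr
              exact hle v N
          _ ≤ 1 := by rw [mul_one]; exact hk.le
      · exact key _ v hv
  refine ((hfin (w (algebraMap R K N) * max B 1)).image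
    fun r => algebraMap R K r / algebraMap R K N).subset ?_
  rintro a ⟨ha1, ha2⟩
  have hNK : algebraMap R K N ≠ 0 := by simpa using hN0
  have hint : ∀ v : HeightOneSpectrum R, v.valuation K (algebraMap R K N * a) ≤ 1 := by
    intro v
    have : abs (some v) (algebraMap R K N * a) ≤ 1 := by
      rw [map_mul]
      by_cases hv : some v ∈ T
      · exact (mul_le_mul_of_nonneg_left (ha2 _ hv) (by positivity)).trans (hN v hv)
      · exact mul_le_one₀ (hle v N) (by positivity) (ha1 _ hv)
    exact (WithZeroMulInt.toNNReal_le_one_iff (hb v)).1 (by exact_mod_cast this)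
  obtain ⟨r, hr⟩ := HeightOneSpectrum.mem_integers_of_valuation_le_one K _ hint
  refine ⟨r, ?_, by simp only [hr]; field_simp⟩
  change w (algebraMap R K r) ≤ _
  rw [hr, map_mul]
  gcongr
  by_cases h : none ∈ T
  · exact (ha2 _ h).trans (le_max_left _ _)
  · exact (ha1 _ h).trans (le_max_right _ _)

end PrincipalIdealDomain

theorem nonempty_placeSystem_rat : Nonempty (PlaceSystem ℚ) := by
  have habs : ∀ r : ℤ, Rat.AbsoluteValue.real (algebraMap ℤ ℚ r) = ((|r| : ℤ) : ℝ) := by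
    intro r
    simp [Rat.AbsoluteValue.real_eq_abs]
  refine nonempty_placeSystem (R := ℤ) Rat.AbsoluteValue.real
    ⟨⟨ℂ, NormedField.toAbsoluteValue ℂ, fun h => ?_, fun x => ?_⟩⟩ (fun r hr => ?_) (fun r hr => ?_)
    fun B => ?_
  · have := h 1 1
    norm_num [Rat.AbsoluteValue.real_eq_abs] at this
  · simp [Rat.AbsoluteValue.real_eq_abs, NormedField.toAbsoluteValue]
  · rw [habs]
    have := (Int.prime_iff_natAbs_prime.1 hr).one_lt
    rw [Int.abs_eq_natAbs]
    exact_mod_cast this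
  · rw [habs, Int.isUnit_iff_abs_eq.1 hr]
    simp
  · simp only [habs]
    refine (Set.finite_Icc (-⌊B⌋) ⌊B⌋).subset fun r hr => ?_
    exact abs_le.1 (Int.le_floor.2 hr)

open scoped Classical in
/-- The absolute value at infinity of `k(t)`, normalized by `|t| = b`. -/
noncomputable def ratFuncInftyAbs (k : Type) [Field k] (b : ℝ) (hb : 1 < b) :
    AbsoluteValue (RatFunc k) ℝ where
  toFun x := if x = 0 then 0 else b ^ x.intDegree
  map_mul' x y := by
    by_cases hx : x = 0
    · simp [hx]
    by_cases hy : y = 0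
    · simp [hy]
    simp only [hx, hy, mul_eq_zero, or_self, if_false]
    rw [RatFunc.intDegree_mul hx hy, zpow_add₀ (by positivity)]
  nonneg' x := by positivity
  eq_zero' x := by
    have : ∀ n : ℤ, b ^ n ≠ 0 := fun n => by positivity
    simp [this]
  add_le' x y := by
    by_cases hx : x = 0
    · simp [hx]
    by_cases hy : y = 0
    · simp [hy]
    by_cases hxy : x + y = 0
    · simp only [hxy, if_true]
      positivity
    simp only [hx, hy, hxy, if_false]
    rcases le_max_iff.1 (RatFunc.intDegree_add_le hy hxy) with h | h
    · exact (zpow_le_zpow_right₀ hb.le h).trans (le_add_of_nonneg_right (by positivity))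
    · exact (zpow_le_zpow_right₀ hb.le h).trans (le_add_of_nonneg_left (by positivity))

theorem ratFuncInftyAbs_apply {k : Type} [Field k] {b : ℝ} (hb : 1 < b) {x : RatFunc k}
    (hx : x ≠ 0) : ratFuncInftyAbs k b hb x = b ^ x.intDegree := if_neg hx

theorem isNonarchimedean_ratFuncInftyAbs (k : Type) [Field k] (b : ℝ) (hb : 1 < b) :
    IsNonarchimedean (ratFuncInftyAbs k b hb) := by
  intro x y
  by_cases hx : x = 0
  · simp [hx]
  by_cases hy : y = 0
  · simp [hy]
  by_cases hxy : x + y = 0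
  · simp [hxy]
  rw [ratFuncInftyAbs_apply hb hx, ratFuncInftyAbs_apply hb hy, ratFuncInftyAbs_apply hb hxy]
  rcases le_max_iff.1 (RatFunc.intDegree_add_le hy hxy) with h | h
  · exact (zpow_le_zpow_right₀ hb.le h).trans (le_max_left _ _)
  · exact (zpow_le_zpow_right₀ hb.le h).trans (le_max_right _ _)

theorem nonempty_placeSystem_ratFunc (k : Type) [Field k] [Finite k] :
    Nonempty (PlaceSystem (RatFunc k)) := by
  have hb : (1 : ℝ) < 2 := one_lt_two
  have habs : ∀ r : k[X], r ≠ 0 →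
      ratFuncInftyAbs k 2 hb (algebraMap k[X] (RatFunc k) r) = 2 ^ r.natDegree := by
    intro r hr
    rw [ratFuncInftyAbs_apply hb (by simpa using hr), RatFunc.intDegree_polynomial, zpow_natCast]
  refine nonempty_placeSystem (R := k[X]) (ratFuncInftyAbs k 2 hb)
    (nonempty_closedExtension _ (isNonarchimedean_ratFuncInftyAbs k 2 hb) ?_) (fun r hr => ?_)
    (fun r hr => ?_) fun B => ?_
  · refine ⟨RatFunc.X, RatFunc.X_ne_zero, ?_⟩
    rw [ratFuncInftyAbs_apply hb RatFunc.X_ne_zero, RatFunc.intDegree_X]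
    norm_num
  · rw [habs r hr.ne_zero]
    exact one_lt_pow₀ hb hr.irreducible.natDegree_pos.ne'
  · rw [habs r hr.ne_zero, Polynomial.natDegree_eq_zero_of_isUnit hr, pow_zero]
  · obtain ⟨n, hn⟩ := pow_unbounded_of_one_lt B hb
    have : Finite (Polynomial.degreeLT k n) :=
      Finite.of_equiv _ (Polynomial.degreeLTEquiv k n).toEquiv.symm
    refine (Set.toFinite (Polynomial.degreeLT k n : Set k[X])).subset fun r hr => ?_
    rw [SetLike.mem_coe, Polynomial.mem_degreeLT]
    by_cases h0 : r = 0
    · simp [h0]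
    rw [Polynomial.degree_eq_natDegree h0]
    have h1 : (2 : ℝ) ^ r.natDegree ≤ B := by rw [← habs r h0]; exact hr
    exact_mod_cast (pow_lt_pow_iff_right₀ hb).1 (h1.trans_lt hn)

/-! ### Growth along the orbit and local estimates -/

open Filter in
/-- Suppose that nonnegative sequences `D v`, for `v` in a finite set, have a sum that is unbounded
and grows at each step at least by the factor `d`, up to a constant, while each large term `D v n`
is followed by one that is not much smaller and at most about `d - 1` times as large. This is
impossible: along an ultrafilter, the set of `v` whose `k`-th shift tends to infinity grows with
`k`; once it is maximal, its members grow too slowly, and the others stay bounded. -/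
theorem growth_contradiction {V : Type*} [Fintype V] (D : V → ℕ → ℝ) (d C R : ℝ) (hd : 2 ≤ d)
    (hD : ∀ v n, 0 ≤ D v n)
    (hsum : ∀ n, d * ∑ v, D v n - C ≤ ∑ v, D v (n + 1))
    (hlower : ∀ v n, R < D v n → D v n - C ≤ D v (n + 1))
    (hupper : ∀ v n, R < D v n → D v (n + 1) ≤ (d - 1) * D v n + C)
    (hunb : ∀ B, ∃ n, B < ∑ v, D v n) : False := by
  classical
  set H : ℕ → ℝ := fun n => ∑ v, D v n with hH
  have hH0 : ∀ n, 0 ≤ H n := fun n => Finset.sum_nonneg fun v _ => hD v n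
  -- `H` tends to infinity: once above `|C| + 1` it increases by at least `1` at each step
  have hHtop : Tendsto H atTop atTop := by
    obtain ⟨N, hN⟩ := hunb (|C| + 1)
    have hstep : ∀ k : ℕ, |C| + 1 + k ≤ H (N + k) := by
      intro k
      induction k with
      | zero => simpa using hN.le
      | succ k ih =>
        have h1 := hsum (N + k)
        have h2 := le_abs_self C
        have h3 : 2 * H (N + k) ≤ d * H (N + k) := mul_le_mul_of_nonneg_right hd (hH0 _)
        change d * H (N + k) - C ≤ H (N + (k + 1)) at h1
        push_cast
        have h4 := abs_nonneg C
        have h5 : (0 : ℝ) ≤ k := by positivity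
        linarith
    rw [← tendsto_add_atTop_iff_nat N]
    refine tendsto_atTop_mono (fun k => ?_)
      (tendsto_atTop_add_const_left atTop (|C| + 1) tendsto_natCast_atTop_atTop)
    rw [add_comm k N]
    exact hstep k
  let U : Ultrafilter ℕ := Ultrafilter.of atTop
  have hU : (U : Filter ℕ) ≤ atTop := Ultrafilter.of_le atTop
  let cap : ℕ → Finset V := fun k =>
    Finset.univ.filter fun v => Tendsto (fun N => D v (N + k)) U atTop
  have hmono : ∀ k, cap k ⊆ cap (k + 1) := by
    intro k v hv
    simp only [cap, Finset.mem_filter, Finset.mem_univ, true_and] at hv ⊢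
    refine tendsto_atTop_mono' (U : Filter ℕ) ?_
      (tendsto_atTop_add_const_right (U : Filter ℕ) (-C) hv)
    filter_upwards [hv.eventually_gt_atTop R] with N hN
    have := hlower v _ hN
    rw [← add_assoc]
    linarith
  -- the cardinality of the increasing sequence `cap` becomes stationary
  obtain ⟨k, hk⟩ : ∃ k, cap (k + 1) = cap k := by
    by_contra! hne
    have hcard : ∀ k, k ≤ (cap k).card := by
      intro k
      induction k with
      | zero => simp
      | succ k ih =>
        exact ih.trans_lt (Finset.card_lt_card ((hmono k).ssubset_of_ne (hne k).symm))
    exact absurd ((hcard (Fintype.card V + 1)).trans (Finset.card_le_univ _)) (by omega)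
  have hbound : ∀ v, ∃ B, ∀ᶠ N in U, D v (N + (k + 1)) ≤ (d - 1) * D v (N + k) + B := by
    intro v
    by_cases hv : v ∈ cap k
    · refine ⟨C, ?_⟩
      simp only [cap, Finset.mem_filter, Finset.mem_univ, true_and] at hv
      filter_upwards [hv.eventually_gt_atTop R] with N hN
      rw [← add_assoc]
      exact hupper v _ hN
    · rw [← hk] at hv
      simp only [cap, Finset.mem_filter, Finset.mem_univ, true_and, tendsto_atTop, not_forall] at hv
      obtain ⟨B, hB⟩ := hv
      refine ⟨B, ?_⟩
      filter_upwards [Ultrafilter.eventually_not.2 hB] with N hN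
      have := mul_nonneg (by linarith : 0 ≤ d - 1) (hD v (N + k))
      linarith
  choose B hB using hbound
  have hHk : ∀ᶠ N in (U : Filter ℕ), C + ∑ v, B v < H (N + k) :=
    ((tendsto_add_atTop_iff_nat k).2 hHtop |>.mono_left hU).eventually_gt_atTop _
  obtain ⟨N, hN1, hN2⟩ := ((Filter.eventually_all.2 hB).and hHk).exists
  have h1 : H (N + (k + 1)) ≤ (d - 1) * H (N + k) + ∑ v, B v := by
    simp only [hH]
    rw [Finset.mul_sum, ← Finset.sum_add_distrib]
    exact Finset.sum_le_sum fun v _ => hN1 v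
  have h2 := hsum (N + k)
  change d * H (N + k) - C ≤ H (N + (k + 1)) at h2
  linarith

section LocalEstimates

variable {k : Type*} [Field k] (v : AbsoluteValue k ℝ)

theorem exists_abs_eval_le (f : k[X]) (n : ℕ) (hn : f.natDegree ≤ n) :
    ∃ C, 0 < C ∧ ∀ x, v (f.eval x) ≤ C * max 1 (v x) ^ n := by
  refine ⟨∑ i ∈ Finset.range (n + 1), v (f.coeff i) + 1, by positivity, fun x => ?_⟩
  rw [Polynomial.eval_eq_sum_range' (Nat.lt_succ_of_le hn)]
  refine (v.sum_le _ _).trans ?_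
  rw [add_mul, Finset.sum_mul]
  refine le_add_of_le_of_nonneg (Finset.sum_le_sum fun i hi => ?_) (by positivity)
  rw [map_mul, map_pow]
  gcongr
  calc v x ^ i ≤ max 1 (v x) ^ i := by gcongr; exact le_max_right _ _
    _ ≤ _ := pow_le_pow_right₀ (le_max_left _ _) (Nat.lt_succ_iff.1 (Finset.mem_range.1 hi))

theorem exists_le_abs_eval (f : k[X]) (hf : f ≠ 0) :
    ∃ c R, 0 < c ∧ 1 ≤ R ∧ ∀ x, R ≤ v x → c * v x ^ f.natDegree ≤ v (f.eval x) := by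
  have hlc : 0 < v f.leadingCoeff := v.pos (by simpa using hf)
  rcases Nat.eq_zero_or_pos f.natDegree with h0 | hpos
  · refine ⟨v f.leadingCoeff, 1, hlc, le_rfl, fun x _ => ?_⟩
    rw [h0, pow_zero, mul_one, Polynomial.eq_C_of_natDegree_eq_zero h0]
    simp
  obtain ⟨C, hC, hCx⟩ := exists_abs_eval_le v f.eraseLead (f.natDegree - 1)
    f.eraseLead_natDegree_le
  refine ⟨v f.leadingCoeff / 2, max 1 (2 * C / v f.leadingCoeff), by positivity, le_max_left _ _,
    fun x hx => ?_⟩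
  have hx1 : 1 ≤ v x := (le_max_left _ _).trans hx
  have hx2 : 2 * C ≤ v x * v f.leadingCoeff := (div_le_iff₀ hlc).1 ((le_max_right _ _).trans hx)
  have h1 : f.eval x = f.eraseLead.eval x + f.leadingCoeff * x ^ f.natDegree := by
    have h := congrArg (Polynomial.eval x) f.eraseLead_add_C_mul_X_pow
    rw [Polynomial.eval_add, Polynomial.eval_mul, Polynomial.eval_C, Polynomial.eval_pow,
      Polynomial.eval_X] at h
    exact h.symm
  have h2 := hCx x
  rw [max_eq_right hx1] at h2
  have h3 : v (f.leadingCoeff * x ^ f.natDegree) ≤ v (f.eval x) + v (f.eraseLead.eval x) := by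
    have : f.leadingCoeff * x ^ f.natDegree = f.eval x - f.eraseLead.eval x := by rw [h1]; ring
    rw [this]
    exact v.sub_le_add _ _
  rw [map_mul, map_pow] at h3
  have h4 : C * v x ^ (f.natDegree - 1) ≤ v f.leadingCoeff / 2 * v x ^ f.natDegree := by
    obtain ⟨m, hm⟩ : ∃ m, f.natDegree = m + 1 := ⟨f.natDegree - 1, by omega⟩
    rw [hm, Nat.add_sub_cancel, pow_succ]
    have : 0 ≤ v x ^ m := by positivity
    nlinarith
  linarith

/-- For coprime `f` and `g`, the maximum of the values is bounded below in terms of the degree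
of `f`. -/
theorem exists_le_max_abs_eval (f g : k[X]) (hf : f ≠ 0) (hfg : IsCoprime f g) :
    ∃ c, 0 < c ∧
      ∀ x, c * max 1 (v x) ^ f.natDegree ≤ max (v (f.eval x)) (v (g.eval x)) := by
  obtain ⟨a, b, hab⟩ := hfg
  obtain ⟨c, R, hc, hR, hcx⟩ := exists_le_abs_eval v f hf
  obtain ⟨A, hA, hAx⟩ := exists_abs_eval_le v a _ le_rfl
  obtain ⟨B, hB, hBx⟩ := exists_abs_eval_le v b _ le_rfl
  have hR0 : 0 < R := by linarith
  set M := A * R ^ a.natDegree + B * R ^ b.natDegree with hM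
  have hM0 : 0 < M := by positivity
  refine ⟨min c (1 / (M * R ^ f.natDegree)), by positivity, fun x => ?_⟩
  rcases le_total R (v x) with hx | hx
  · rw [max_eq_right (hR.trans hx)]
    refine le_max_of_le_left (le_trans ?_ (hcx x hx))
    gcongr
    exact min_le_left _ _
  · have hmax : max 1 (v x) ≤ R := max_le hR hx
    have h1 : 1 ≤ M * max (v (f.eval x)) (v (g.eval x)) := by
      have h2 : (1 : k) = a.eval x * f.eval x + b.eval x * g.eval x := by
        rw [← Polynomial.eval_mul, ← Polynomial.eval_mul, ← Polynomial.eval_add, hab,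
          Polynomial.eval_one]
      calc (1 : ℝ) = v (a.eval x * f.eval x + b.eval x * g.eval x) := by rw [← h2, map_one]
        _ ≤ v (a.eval x) * v (f.eval x) + v (b.eval x) * v (g.eval x) := by
          rw [← map_mul, ← map_mul]; exact v.add_le _ _
        _ ≤ A * R ^ a.natDegree * max (v (f.eval x)) (v (g.eval x)) +
            B * R ^ b.natDegree * max (v (f.eval x)) (v (g.eval x)) := by
          gcongr
          · exact (hAx x).trans (by gcongr)
          · exact le_max_left _ _
          · exact (hBx x).trans (by gcongr)
          · exact le_max_right _ _
        _ = _ := by rw [hM]; ring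
    calc _ ≤ 1 / (M * R ^ f.natDegree) * R ^ f.natDegree := by
          gcongr
          exact min_le_right _ _
      _ = 1 / M := by field_simp
      _ ≤ _ := by rw [div_le_iff₀ hM0]; linarith

/-- The contribution `log max(1, |x|)` of an absolute value to the logarithmic height of `x`. -/
noncomputable def logSize (x : k) : ℝ := Real.log (max 1 (v x))

theorem logSize_nonneg (x : k) : 0 ≤ logSize v x := Real.log_nonneg (le_max_left _ _)

/-- The local estimates for one step `x ↦ y = f(x) / g(x)`. The first one, summed over the absolute
values, bounds the growth of the height from below. The other two say that, near the fixed point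
`∞`, the map looks like `x ↦ x ^ e` with `1 ≤ e ≤ deg f - 1`. -/
theorem exists_logSize_bounds (f g : k[X]) (hfg : IsCoprime f g) (hdeg : g.natDegree < f.natDegree)
    (hg : 0 < g.natDegree) :
    ∃ C, 0 ≤ C ∧ ∀ x y, g.eval x ≠ 0 → g.eval x * y = f.eval x →
      (f.natDegree * logSize v x - C ≤ logSize v y + Real.log (v (g.eval x))) ∧
      (C < logSize v x → logSize v x - C ≤ logSize v y) ∧
      (C < logSize v x → logSize v y ≤ (f.natDegree - 1 : ℝ) * logSize v x + C) := by
  have hf0 : f ≠ 0 := by rintro rfl; simp at hdeg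
  have hg0 : g ≠ 0 := by rintro rfl; simp at hg
  obtain ⟨c₁, hc₁, h₁⟩ := exists_le_max_abs_eval v f g hf0 hfg
  obtain ⟨c₂, R₂, hc₂, hR₂, h₂⟩ := exists_le_abs_eval v f hf0
  obtain ⟨c₃, R₃, hc₃, hR₃, h₃⟩ := exists_le_abs_eval v g hg0
  obtain ⟨C₄, hC₄, h₄⟩ := exists_abs_eval_le v f _ le_rfl
  obtain ⟨C₅, hC₅, h₅⟩ := exists_abs_eval_le v g _ le_rfl
  let C := |Real.log c₁| + |Real.log R₂| + |Real.log R₃| + |Real.log (c₂ / C₅)| +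
    |Real.log (C₄ / c₃)|
  refine ⟨C, by positivity, fun x y hgx hxy => ?_⟩
  have n1 := neg_le_abs (Real.log c₁)
  have n2 := le_abs_self (Real.log R₂)
  have n3 := le_abs_self (Real.log R₃)
  have n4 := neg_le_abs (Real.log (c₂ / C₅))
  have n5 := le_abs_self (Real.log (C₄ / c₃))
  have p1 := abs_nonneg (Real.log c₁)
  have p2 := abs_nonneg (Real.log R₂)
  have p3 := abs_nonneg (Real.log R₃)
  have p4 := abs_nonneg (Real.log (c₂ / C₅))
  have p5 := abs_nonneg (Real.log (C₄ / c₃))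
  have hvg : 0 < v (g.eval x) := v.pos hgx
  have hvy : v (g.eval x) * v y = v (f.eval x) := by rw [← map_mul, hxy]
  have hbig : C < logSize v x → R₂ ≤ v x ∧ R₃ ≤ v x := by
    intro h
    have hx : logSize v x = Real.log (v x) := by
      rcases le_total (v x) 1 with h1 | h1
      · have : logSize v x = 0 := by simp [logSize, max_eq_left h1]
        have hC : 0 ≤ C := by positivity
        linarith
      · simp [logSize, max_eq_right h1]
    have hvx : 0 < v x := by
      rcases (v.nonneg x).eq_or_lt with h0 | h0
      · rw [hx, ← h0, Real.log_zero] at h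
        have hC : 0 ≤ C := by positivity
        linarith
      · exact h0
    constructor
    · refine (Real.log_le_log_iff (by linarith) hvx).1 ?_
      simp only [C] at h
      linarith
    · refine (Real.log_le_log_iff (by linarith) hvx).1 ?_
      simp only [C] at h
      linarith
  refine ⟨?_, fun h => ?_, fun h => ?_⟩
  · have h6 : c₁ * max 1 (v x) ^ f.natDegree ≤ max 1 (v y) * v (g.eval x) := by
      refine (h₁ x).trans (max_le ?_ ?_)
      · rw [← hvy, mul_comm]
        gcongr
        exact le_max_right _ _
      · exact le_mul_of_one_le_left hvg.le (le_max_left _ _)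
    have hx0 : 0 < max 1 (v x) := by positivity
    have hy0 : 0 < max 1 (v y) := by positivity
    have h7 := Real.log_le_log (by positivity) h6
    rw [Real.log_mul hc₁.ne' (by positivity), Real.log_mul hy0.ne' hvg.ne', Real.log_pow] at h7
    simp only [logSize, C]
    linarith
  · obtain ⟨hx2, hx3⟩ := hbig h
    have hx1 : 1 ≤ v x := hR₂.trans hx2
    have hx0 : 0 < v x := by linarith
    have h6 : c₂ / C₅ * v x ≤ max 1 (v y) := by
      refine le_max_of_le_right ?_
      have h7 := h₂ x hx2
      have h8 := h₅ x
      rw [max_eq_right hx1] at h8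
      have h9 : c₂ * v x ^ f.natDegree ≤ C₅ * v x ^ g.natDegree * v y := by
        rw [← hvy] at h7
        exact h7.trans (by gcongr)
      have h10 : c₂ * (v x ^ g.natDegree * v x) ≤ C₅ * v x ^ g.natDegree * v y := by
        refine le_trans ?_ h9
        rw [← pow_succ]
        gcongr
        exact hdeg
      rw [div_mul_eq_mul_div, div_le_iff₀ hC₅]
      refine le_of_mul_le_mul_left ?_ (show 0 < v x ^ g.natDegree by positivity)
      linarith
    have h7 := Real.log_le_log (by positivity) h6
    rw [Real.log_mul (by positivity) hx0.ne'] at h7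
    have : logSize v x = Real.log (v x) := by simp [logSize, max_eq_right hx1]
    rw [this]
    simp only [logSize, C]
    linarith
  · obtain ⟨hx2, hx3⟩ := hbig h
    have hx1 : 1 ≤ v x := hR₂.trans hx2
    have hx0 : 0 < v x := by linarith
    have hlx : logSize v x = Real.log (v x) := by simp [logSize, max_eq_right hx1]
    have hlx0 := logSize_nonneg v x
    have hd1 : (2 : ℝ) ≤ f.natDegree := by exact_mod_cast (by omega : 2 ≤ f.natDegree)
    rcases le_total (v y) 1 with hy | hy
    · have : logSize v y = 0 := by simp [logSize, max_eq_left hy]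
      have hC : 0 ≤ C := by positivity
      rw [this]
      have := mul_nonneg (by linarith : (0 : ℝ) ≤ f.natDegree - 1) hlx0
      linarith
    have hly : logSize v y = Real.log (v y) := by simp [logSize, max_eq_right hy]
    have h6 : v y ≤ C₄ / c₃ * v x ^ (f.natDegree - 1) := by
      have h7 := h₃ x hx3
      have h8 := h₄ x
      rw [max_eq_right hx1] at h8
      have h9 : c₃ * v x * v y ≤ C₄ * v x ^ f.natDegree := by
        refine le_trans ?_ h8
        rw [← hvy]
        refine mul_le_mul_of_nonneg_right (le_trans ?_ h7) (v.nonneg y)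
        gcongr
        exact le_self_pow₀ hx1 hg.ne'
      obtain ⟨m, hm⟩ : ∃ m, f.natDegree = m + 1 := ⟨f.natDegree - 1, by omega⟩
      rw [hm, pow_succ] at h9
      rw [hm, Nat.add_sub_cancel, div_mul_eq_mul_div, le_div_iff₀ hc₃]
      refine le_of_mul_le_mul_left ?_ hx0
      linarith
    have h7 := Real.log_le_log (by linarith) h6
    rw [Real.log_mul (by positivity) (by positivity), Real.log_pow,
      Nat.cast_sub (by omega), Nat.cast_one] at h7
    rw [hlx, hly]
    simp only [C]
    linarith

end LocalEstimates

/-! ### Places of finite extensions and the polynomial case -/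

theorem ne_zero_of_mem_coeffs {k : Type*} [Field k] {f : k[X]} {c : k}
    (hc : c ∈ f.coeffs) : c ≠ 0 := by
  obtain ⟨n, hn, rfl⟩ := Polynomial.mem_coeffs_iff.1 hc
  exact Polynomial.mem_support_iff.1 hn

section Nonarchimedean

variable {k : Type*} [Field k] {v : AbsoluteValue k ℝ} (hv : IsNonarchimedean v)
include hv

theorem abs_eval_le_of_coeff_le_one (f : k[X]) (hf : ∀ j, v (f.coeff j) ≤ 1) {n : ℕ}
    (hn : f.natDegree ≤ n) (x : k) : v (f.eval x) ≤ max 1 (v x) ^ n := by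
  rw [Polynomial.eval_eq_sum_range' (Nat.lt_succ_of_le hn)]
  have : ∀ s : Finset ℕ, s ⊆ Finset.range (n + 1) →
      v (∑ i ∈ s, f.coeff i * x ^ i) ≤ max 1 (v x) ^ n := by
    classical
    intro s
    induction s using Finset.induction_on with
    | empty => intro _; simp only [Finset.sum_empty, map_zero]; positivity
    | insert i s his ih =>
      intro hs
      rw [Finset.sum_insert his]
      refine (hv _ _).trans (max_le ?_ (ih ((Finset.subset_insert i s).trans hs)))
      have hi : i ≤ n := Nat.lt_succ_iff.1 (Finset.mem_range.1 (hs (Finset.mem_insert_self i s)))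
      rw [map_mul, map_pow]
      calc _ ≤ 1 * max 1 (v x) ^ i := by
            gcongr
            · exact hf i
            · exact le_max_right _ _
        _ ≤ _ := by rw [one_mul]; exact pow_le_pow_right₀ (le_max_left _ _) hi
  exact this _ subset_rfl

theorem abs_eval_eq_of_one_lt (f : k[X]) (hf : ∀ j, v (f.coeff j) ≤ 1)
    (hlc : v f.leadingCoeff = 1) {x : k} (hx : 1 < v x) :
    v (f.eval x) = v x ^ f.natDegree := by
  rcases Nat.eq_zero_or_pos f.natDegree with h0 | hpos
  · have := Polynomial.eq_C_of_natDegree_eq_zero h0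
    rw [h0, pow_zero, this, Polynomial.eval_C, ← hlc, Polynomial.leadingCoeff, h0]
  have h := congrArg (Polynomial.eval x) f.eraseLead_add_C_mul_X_pow
  rw [Polynomial.eval_add, Polynomial.eval_mul, Polynomial.eval_C, Polynomial.eval_pow,
    Polynomial.eval_X] at h
  have h1 : v (f.leadingCoeff * x ^ f.natDegree) = v x ^ f.natDegree := by
    rw [map_mul, map_pow, hlc, one_mul]
  have h2 : v (f.eraseLead.eval x) < v x ^ f.natDegree := by
    have := abs_eval_le_of_coeff_le_one hv f.eraseLead (fun j => ?_) f.eraseLead_natDegree_le x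
    · refine this.trans_lt ?_
      rw [max_eq_right hx.le]
      exact pow_lt_pow_right₀ hx (by omega)
    · rw [Polynomial.eraseLead_coeff]
      split_ifs
      · simp
      · exact hf j
  rw [← h, hv.add_eq_max_of_ne (by rw [h1]; exact h2.ne), h1, max_eq_right h2.le]

theorem abs_le_one_of_isRoot (f : k[X]) (hm : f.Monic) (hf : ∀ j, v (f.coeff j) ≤ 1) {x : k}
    (hx : f.eval x = 0) : v x ≤ 1 := by
  by_contra! h
  have := abs_eval_eq_of_one_lt hv f hf (by simp [hm.leadingCoeff]) h
  rw [hx, map_zero] at this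
  exact (pow_pos (zero_lt_one.trans h) _).ne this

theorem abs_coeff_prod_le_one (s : Multiset k) (hs : ∀ x ∈ s, v x ≤ 1) (j : ℕ) :
    v ((s.map fun x => Polynomial.X - Polynomial.C x).prod.coeff j) ≤ 1 := by
  induction s using Multiset.induction_on generalizing j with
  | empty =>
    simp only [Multiset.map_zero, Multiset.prod_zero, Polynomial.coeff_one]
    split_ifs <;> simp
  | cons x s ih =>
    have ih' := ih fun y hy => hs y (Multiset.mem_cons_of_mem hy)
    rw [Multiset.map_cons, Multiset.prod_cons, sub_mul, Polynomial.coeff_sub,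
      Polynomial.coeff_C_mul, sub_eq_add_neg]
    refine (hv _ _).trans (max_le ?_ ?_)
    · cases j with
      | zero => simp
      | succ j => rw [Polynomial.coeff_X_mul]; exact ih' j
    · rw [v.map_neg, map_mul]
      exact mul_le_one₀ (hs x (Multiset.mem_cons_self x s)) (v.nonneg _) (ih' j)

end Nonarchimedean

theorem abs_coeff_prod_le {k : Type*} [Field k] (v : AbsoluteValue k ℝ) (s : Multiset k) {B : ℝ}
    (hB : 0 ≤ B) (hs : ∀ x ∈ s, v x ≤ B) (j : ℕ) :
    v ((s.map fun x => Polynomial.X - Polynomial.C x).prod.coeff j) ≤ (1 + B) ^ s.card := by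
  induction s using Multiset.induction_on generalizing j with
  | empty =>
    simp only [Multiset.map_zero, Multiset.prod_zero, Polynomial.coeff_one]
    split_ifs <;> simp
  | cons x s ih =>
    have ih' := ih fun y hy => hs y (Multiset.mem_cons_of_mem hy)
    rw [Multiset.map_cons, Multiset.prod_cons, sub_mul, Polynomial.coeff_sub,
      Polynomial.coeff_C_mul, Multiset.card_cons, pow_succ', add_mul, one_mul]
    refine (v.sub_le_add _ _).trans (add_le_add ?_ ?_)
    · cases j with
      | zero => simp only [Polynomial.coeff_X_mul_zero, map_zero]; positivity
      | succ j => rw [Polynomial.coeff_X_mul]; exact ih' j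
    · rw [map_mul]
      exact mul_le_mul (hs x (Multiset.mem_cons_self x s)) (ih' j) (v.nonneg _) hB

namespace PlaceSystem

variable {K : Type} [Field K] (P : PlaceSystem K) {E : Type*} [Field E] [Algebra K E]

/-- The absolute value on an extension `E` of `K` attached to an embedding of `E` into the
algebraically closed field at the place `i`. -/
noncomputable def embAbs (i : P.ι) (σ : E →ₐ[K] (P.ext i).carrier) : AbsoluteValue E ℝ :=
  (P.ext i).abs.comp (f := (σ : E →+* (P.ext i).carrier)) (RingHom.injective _)

theorem embAbs_apply (i : P.ι) (σ : E →ₐ[K] (P.ext i).carrier) (x : E) :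
    P.embAbs i σ x = (P.ext i).abs (σ x) := rfl

theorem embAbs_algebraMap (i : P.ι) (σ : E →ₐ[K] (P.ext i).carrier) (x : K) :
    P.embAbs i σ (algebraMap K E x) = P.abs i x := by
  rw [embAbs_apply, AlgHom.commutes, (P.ext i).abs_algebraMap]

theorem isNonarchimedean_embAbs {i : P.ι} (hi : i ≠ P.infty) (σ : E →ₐ[K] (P.ext i).carrier) :
    IsNonarchimedean (P.embAbs i σ) := fun x y => by
  simp only [embAbs_apply, map_add]
  exact (P.ext i).isNonarchimedean (P.isNonarchimedean i hi) _ _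

theorem finite_one_lt_embAbs [FiniteDimensional K E] (a : E) :
    {i | ∃ σ : E →ₐ[K] (P.ext i).carrier, 1 < P.embAbs i σ a}.Finite := by
  classical
  have hfin : (⋃ c ∈ (minpoly K a).coeffs, {i | P.abs i c ≠ 1}).Finite :=
    Set.Finite.biUnion (Finset.finite_toSet _) fun c hc =>
      P.finite_abs_ne_one c (ne_zero_of_mem_coeffs hc)
  refine ((Set.finite_singleton P.infty).union hfin).subset ?_
  rintro i ⟨σ, hσ⟩
  by_contra hi
  simp only [Set.mem_union, Set.mem_singleton_iff, Set.mem_iUnion, not_or, not_exists] at hi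
  obtain ⟨hi1, hi2⟩ := hi
  refine hσ.not_ge ?_
  refine abs_le_one_of_isRoot ((P.ext i).isNonarchimedean (P.isNonarchimedean i hi1))
    ((minpoly K a).map (algebraMap K (P.ext i).carrier))
    ((minpoly.monic (Algebra.IsIntegral.isIntegral a)).map _) (fun j => ?_) (x := σ a) ?_
  · rw [Polynomial.coeff_map, (P.ext i).abs_algebraMap]
    by_cases h0 : (minpoly K a).coeff j = 0
    · simp [h0]
    · have := hi2 _ (Polynomial.coeff_mem_coeffs h0)
      exact (not_not.1 this).le
  · rw [Polynomial.eval_map_algebraMap, Polynomial.aeval_algHom_apply, minpoly.aeval, map_zero]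

theorem finite_embAbs_ne_one [FiniteDimensional K E] (a : E) (ha : a ≠ 0) :
    {i | ∃ σ : E →ₐ[K] (P.ext i).carrier, P.embAbs i σ a ≠ 1}.Finite := by
  refine ((P.finite_one_lt_embAbs a).union (P.finite_one_lt_embAbs a⁻¹)).subset ?_
  rintro i ⟨σ, hσ⟩
  rcases hσ.lt_or_gt with h | h
  · refine Or.inr ⟨σ, ?_⟩
    rw [map_inv₀]
    exact (one_lt_inv₀ ((P.embAbs i σ).pos ha)).2 h
  · exact Or.inl ⟨σ, h⟩

/-- The product formula, for elements that are units outside of a finite set of places. -/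
theorem prod_embAbs [FiniteDimensional K E] [Algebra.IsSeparable K E] (T : Finset P.ι) (u : E)
    (hu : u ≠ 0) (hT : ∀ i ∉ T, ∀ σ : E →ₐ[K] (P.ext i).carrier, P.embAbs i σ u = 1) :
    ∏ i ∈ T, ∏ σ : E →ₐ[K] (P.ext i).carrier, P.embAbs i σ u = 1 := by
  have hN : ∀ i, P.abs i (Algebra.norm K u) =
      ∏ σ : E →ₐ[K] (P.ext i).carrier, P.embAbs i σ u := by
    intro i
    rw [← (P.ext i).abs_algebraMap, Algebra.norm_eq_prod_embeddings, map_prod]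
    rfl
  simp only [← hN]
  rw [← finprod_eq_prod_of_mulSupport_subset, P.finprod_abs _ (Algebra.norm_ne_zero_iff.2 hu)]
  intro i hi
  by_contra h
  refine hi ?_
  change P.abs i _ = 1
  rw [hN]
  exact Finset.prod_eq_one fun σ _ => hT i h σ

/-- Northcott's theorem for integral elements. -/
theorem finite_embAbs_le [FiniteDimensional K E] (T : Finset P.ι) (hT : P.infty ∈ T) (B : ℝ) :
    {x : E | (∀ i ∉ T, ∀ σ : E →ₐ[K] (P.ext i).carrier, P.embAbs i σ x ≤ 1) ∧
      ∀ i ∈ T, ∀ σ : E →ₐ[K] (P.ext i).carrier, P.embAbs i σ x ≤ B}.Finite := by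
  classical
  set n := Module.finrank K E
  set B' := max B 0 with hB'
  have hB0 : 0 ≤ B' := le_max_right _ _
  refine (Polynomial.bUnion_roots_finite (algebraMap K E) n
    (P.northcott T ((1 + B') ^ n))).subset ?_
  rintro x ⟨hx1, hx2⟩
  have hmin := minpoly.monic (Algebra.IsIntegral.isIntegral (R := K) x)
  simp only [Set.mem_iUnion]
  refine ⟨minpoly K x, ⟨minpoly.natDegree_le x, fun j => ?_⟩, ?_⟩
  · have hsplit : ∀ i, ((minpoly K x).map (algebraMap K (P.ext i).carrier)) =
        (((minpoly K x).map (algebraMap K (P.ext i).carrier)).roots.map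
          fun y => Polynomial.X - Polynomial.C y).prod := fun i =>
      (IsAlgClosed.splits _).eq_prod_roots_of_monic (hmin.map _)
    have hroot : ∀ i, ∀ y ∈ ((minpoly K x).map (algebraMap K (P.ext i).carrier)).roots,
        ∃ σ : E →ₐ[K] (P.ext i).carrier, σ x = y := by
      intro i y hy
      have : y ∈ (minpoly K x).rootSet (P.ext i).carrier := by
        rw [Polynomial.rootSet_def]
        simpa [Polynomial.aroots] using hy
      rw [← Algebra.IsAlgebraic.range_eval_eq_rootSet_minpoly] at this
      exact this
    have hcoeff : ∀ i, P.abs i ((minpoly K x).coeff j) =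
        (P.ext i).abs (((minpoly K x).map (algebraMap K (P.ext i).carrier)).coeff j) := by
      intro i
      rw [Polynomial.coeff_map, (P.ext i).abs_algebraMap]
    constructor
    · intro i hi
      rw [hcoeff, hsplit]
      refine abs_coeff_prod_le_one ((P.ext i).isNonarchimedean
        (P.isNonarchimedean i (ne_of_mem_of_not_mem hT hi).symm)) _ (fun y hy => ?_) j
      obtain ⟨σ, rfl⟩ := hroot i y hy
      exact hx1 i hi σ
    · intro i hi
      rw [hcoeff, hsplit]
      refine (abs_coeff_prod_le _ _ hB0 (fun y hy => ?_) j).trans ?_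
      · obtain ⟨σ, rfl⟩ := hroot i y hy
        exact (hx2 i hi σ).trans (le_max_left _ _)
      · refine pow_le_pow_right₀ (by linarith) ((Polynomial.card_roots' _).trans ?_)
        exact Polynomial.natDegree_map_le.trans (minpoly.natDegree_le x)
  · have h0 : (minpoly K x).map (algebraMap K E) ≠ 0 := (hmin.map _).ne_zero
    simp [Polynomial.mem_roots h0, Polynomial.IsRoot, Polynomial.eval_map_algebraMap]

/-- The dynamical heart of the matter: an infinite orbit of `x ↦ f(x) / g(x)` contains only
finitely many integral points if `∞` is a fixed point that is not totally ramified. -/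
theorem not_infinitely_often_integral [FiniteDimensional K E] [Algebra.IsSeparable K E]
    (f g : E[X]) (hfg : IsCoprime f g) (hdeg : g.natDegree < f.natDegree)
    (hg : 0 < g.natDegree) (z : ℕ → E) (hz : Function.Injective z)
    (hgz : ∀ n, g.eval (z n) ≠ 0) (hstep : ∀ n, g.eval (z n) * z (n + 1) = f.eval (z n))
    (T₀ : Finset P.ι) (hint : ∀ N, ∃ n ≥ N, ∀ i ∉ T₀, ∀ σ : E →ₐ[K] (P.ext i).carrier,
      P.embAbs i σ (z n) ≤ 1) : False := by
  classical
  obtain ⟨a, b, hab⟩ := id hfg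
  -- enlarge the set of places so that the map has good reduction outside of it
  obtain ⟨T, hT₀, hTinf, hT⟩ : ∃ T : Finset P.ι, T₀ ⊆ T ∧ P.infty ∈ T ∧
      ∀ p ∈ ({f, g, a, b} : Finset E[X]), ∀ i ∉ T, ∀ σ : E →ₐ[K] (P.ext i).carrier,
        ∀ c ∈ p.coeffs, P.embAbs i σ c = 1 := by
    have hfin : (⋃ p ∈ ({f, g, a, b} : Finset E[X]), ⋃ c ∈ p.coeffs,
        {i | ∃ σ : E →ₐ[K] (P.ext i).carrier, P.embAbs i σ c ≠ 1}).Finite :=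
      Set.Finite.biUnion (Finset.finite_toSet _) fun p _ =>
        Set.Finite.biUnion (Finset.finite_toSet _) fun c hc =>
          P.finite_embAbs_ne_one c (ne_zero_of_mem_coeffs hc)
    refine ⟨T₀ ∪ {P.infty} ∪ hfin.toFinset, ?_, by simp, ?_⟩
    · rw [Finset.union_assoc]
      exact Finset.subset_union_left
    · intro p hp i hi σ c hc
      by_contra hne
      refine hi (Finset.mem_union_right _ ?_)
      rw [Set.Finite.mem_toFinset]
      exact Set.mem_biUnion (x := p) hp (Set.mem_biUnion (x := c) hc ⟨σ, hne⟩)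
  have hle : ∀ p ∈ ({f, g, a, b} : Finset E[X]), ∀ i ∉ T, ∀ σ : E →ₐ[K] (P.ext i).carrier,
      ∀ j, P.embAbs i σ (p.coeff j) ≤ 1 := by
    intro p hp i hi σ j
    by_cases h0 : p.coeff j = 0
    · simp [h0]
    · exact (hT p hp i hi σ _ (Polynomial.coeff_mem_coeffs h0)).le
  have hf0 : f ≠ 0 := by rintro rfl; simp at hdeg
  have hna : ∀ i ∉ T, ∀ σ : E →ₐ[K] (P.ext i).carrier, IsNonarchimedean (P.embAbs i σ) :=
    fun i hi σ => P.isNonarchimedean_embAbs (ne_of_mem_of_not_mem hTinf hi).symm σ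
  -- integrality propagates backwards, because `∞` is fixed
  have hback : ∀ i ∉ T, ∀ σ : E →ₐ[K] (P.ext i).carrier, ∀ n,
      P.embAbs i σ (z (n + 1)) ≤ 1 → P.embAbs i σ (z n) ≤ 1 := by
    intro i hi σ n h
    by_contra! hlt
    have h1 := abs_eval_eq_of_one_lt (hna i hi σ) f (hle f (by simp) i hi σ)
      (hT f (by simp) i hi σ _ (Polynomial.coeff_mem_coeffs (by simpa using hf0))) hlt
    have h2 := abs_eval_le_of_coeff_le_one (hna i hi σ) g (hle g (by simp) i hi σ) le_rfl (z n)
    rw [max_eq_right hlt.le] at h2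
    have h3 := pow_lt_pow_right₀ hlt hdeg
    rw [← h1, ← hstep, map_mul] at h3
    have h4 := mul_le_of_le_one_right ((P.embAbs i σ).nonneg (g.eval (z n))) h
    linarith
  have hzint : ∀ n, ∀ i ∉ T, ∀ σ : E →ₐ[K] (P.ext i).carrier, P.embAbs i σ (z n) ≤ 1 := by
    intro n i hi σ
    obtain ⟨m, hm, hm1⟩ := hint n
    obtain ⟨k, rfl⟩ := Nat.exists_eq_add_of_le hm
    have h1 := hm1 i (fun h => hi (hT₀ h)) σ
    clear hm hm1
    induction k with
    | zero => exact h1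
    | succ k ih => exact ih (hback i hi σ _ h1)
  have hgunit : ∀ n, ∀ i ∉ T, ∀ σ : E →ₐ[K] (P.ext i).carrier,
      P.embAbs i σ (g.eval (z n)) = 1 := by
    intro n i hi σ
    have hmax : max 1 (P.embAbs i σ (z n)) = 1 := max_eq_left (hzint n i hi σ)
    have hone : ∀ p ∈ ({f, g, a, b} : Finset E[X]), P.embAbs i σ (p.eval (z n)) ≤ 1 := by
      intro p hp
      simpa [hmax] using
        abs_eval_le_of_coeff_le_one (hna i hi σ) p (hle p hp i hi σ) le_rfl (z n)
    refine le_antisymm (hone g (by simp)) ?_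
    have h2 : (1 : E) = a.eval (z n) * f.eval (z n) + b.eval (z n) * g.eval (z n) := by
      rw [← Polynomial.eval_mul, ← Polynomial.eval_mul, ← Polynomial.eval_add, hab,
        Polynomial.eval_one]
    have h3 : P.embAbs i σ (f.eval (z n)) ≤ P.embAbs i σ (g.eval (z n)) := by
      rw [← hstep, map_mul]
      exact mul_le_of_le_one_right ((P.embAbs i σ).nonneg _) (hzint (n + 1) i hi σ)
    rw [← map_one (P.embAbs i σ), h2]
    refine (hna i hi σ _ _).trans (max_le ?_ ?_)
    · rw [map_mul]
      exact (mul_le_of_le_one_left ((P.embAbs i σ).nonneg _) (hone a (by simp))).trans h3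
    · rw [map_mul]
      exact mul_le_of_le_one_left ((P.embAbs i σ).nonneg _) (hone b (by simp))
  let V := Σ i : T, (E →ₐ[K] (P.ext i.1).carrier)
  let absV : V → AbsoluteValue E ℝ := fun w => P.embAbs w.1.1 w.2
  have hprod : ∀ n, ∑ w : V, Real.log (absV w (g.eval (z n))) = 0 := by
    intro n
    rw [← Real.log_prod (fun w _ => ((absV w).pos (hgz n)).ne')]
    have := P.prod_embAbs T (g.eval (z n)) (hgz n) (hgunit n)
    rw [← Finset.prod_coe_sort] at this
    rw [Fintype.prod_sigma, this, Real.log_one]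
  choose C hC0 hC using fun w : V => exists_logSize_bounds (absV w) f g hfg hdeg hg
  have hCle : ∀ w, C w ≤ ∑ w, C w := fun w =>
    Finset.single_le_sum (fun w _ => hC0 w) (Finset.mem_univ w)
  refine growth_contradiction (fun w n => logSize (absV w) (z n)) f.natDegree (∑ w, C w)
    (∑ w, C w) (by exact_mod_cast (by omega : 2 ≤ f.natDegree))
    (fun w n => logSize_nonneg _ _) (fun n => ?_) (fun w n h => ?_) (fun w n h => ?_) fun B => ?_
  · have h1 := Finset.sum_le_sum fun w (_ : w ∈ Finset.univ) =>
      (hC w _ _ (hgz n) (hstep n)).1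
    rw [Finset.sum_add_distrib, hprod, add_zero, Finset.sum_sub_distrib, ← Finset.mul_sum] at h1
    exact h1
  · exact (sub_le_sub_left (hCle w) _).trans
      ((hC w _ _ (hgz n) (hstep n)).2.1 ((hCle w).trans_lt h))
  · exact ((hC w _ _ (hgz n) (hstep n)).2.2 ((hCle w).trans_lt h)).trans
      (add_le_add_right (hCle w) _)
  · by_contra! hcon
    refine Set.infinite_range_of_injective hz ((P.finite_embAbs_le T hTinf (Real.exp B)).subset ?_)
    rintro _ ⟨n, rfl⟩
    refine ⟨hzint n, fun i hi σ => ?_⟩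
    let w : V := ⟨⟨i, hi⟩, σ⟩
    have h1 : logSize (absV w) (z n) ≤ B :=
      (Finset.single_le_sum (fun w _ => logSize_nonneg (absV w) (z n))
        (Finset.mem_univ w)).trans (hcon n)
    exact (le_max_right _ _).trans ((Real.log_le_iff_le_exp (by positivity)).1 h1)

end PlaceSystem

/-! ### Homogeneous lifts of rational functions -/

section Lift

variable {F : Type u} [Field F]

/-- The value at `(x, y)` of the binary form of degree `d` with dehomogenization `f`; it is
meaningful if `deg f ≤ d`. -/
noncomputable def homEval (f : F[X]) (d : ℕ) {A : Type*} [CommRing A] [Algebra F A] (x y : A) : A :=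
  ∑ i ∈ Finset.range (d + 1), algebraMap F A (f.coeff i) * x ^ i * y ^ (d - i)

section

variable (f : F[X]) (d : ℕ) {A B : Type*} [CommRing A] [Algebra F A] [CommRing B] [Algebra F B]

theorem map_homEval (ψ : A →ₐ[F] B) (x y : A) :
    ψ (homEval f d x y) = homEval f d (ψ x) (ψ y) := by
  simp [homEval]

theorem homEval_mul (c x y : A) : homEval f d (c * x) (c * y) = c ^ d * homEval f d x y := by
  rw [homEval, homEval, Finset.mul_sum]
  refine Finset.sum_congr rfl fun i hi => ?_
  have hi : i ≤ d := Nat.lt_succ_iff.1 (Finset.mem_range.1 hi)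
  have hc : c ^ d = c ^ i * c ^ (d - i) := by rw [← pow_add, Nat.add_sub_cancel' hi]
  rw [mul_pow, mul_pow, hc]
  ring

theorem homEval_one_right (hf : f.natDegree ≤ d) (x : A) :
    homEval f d x 1 = Polynomial.aeval x f := by
  rw [Polynomial.aeval_eq_sum_range' (Nat.lt_succ_of_le hf)]
  simp [homEval, Algebra.smul_def]

theorem homEval_zero_right (x : A) : homEval f d x 0 = algebraMap F A (f.coeff d) * x ^ d := by
  rw [homEval, Finset.sum_eq_single d]
  · simp
  · intro i hi hid
    have hi : i < d + 1 := Finset.mem_range.1 hi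
    rw [zero_pow (by omega), mul_zero]
  · simp

theorem homEval_of_ne_zero {L : Type*} [Field L] [Algebra F L] (hf : f.natDegree ≤ d) (x : L)
    {y : L} (hy : y ≠ 0) : homEval f d x y = y ^ d * Polynomial.aeval (x / y) f := by
  rw [← homEval_one_right f d hf, ← homEval_mul, mul_div_cancel₀ _ hy, mul_one]

theorem natDegree_homEval_le {p q : F[X]} {e : ℕ} (hp : p.natDegree ≤ e) (hq : q.natDegree ≤ e) :
    (homEval f d p q).natDegree ≤ d * e := by
  refine Polynomial.natDegree_sum_le_of_forall_le _ _ fun i hi => ?_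
  have hi : i ≤ d := Nat.lt_succ_iff.1 (Finset.mem_range.1 hi)
  rw [mul_assoc]
  refine (Polynomial.natDegree_C_mul_le _ _).trans (Polynomial.natDegree_mul_le_of_le
    (Polynomial.natDegree_pow_le_of_le i hp) (Polynomial.natDegree_pow_le_of_le (d - i) hq) |>.trans
      ?_)
  rw [← add_mul, Nat.add_sub_cancel' hi]

theorem coeff_homEval {p q : F[X]} {e : ℕ} (hp : p.natDegree ≤ e) (hq : q.natDegree ≤ e) :
    (homEval f d p q).coeff (d * e) = homEval f d (p.coeff e) (q.coeff e) := by
  rw [homEval, homEval, Polynomial.finsetSum_coeff]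
  refine Finset.sum_congr rfl fun i hi => ?_
  have hi : i ≤ d := Nat.lt_succ_iff.1 (Finset.mem_range.1 hi)
  have hde : d * e = i * e + (d - i) * e := by rw [← add_mul, Nat.add_sub_cancel' hi]
  rw [mul_assoc, mul_assoc, Polynomial.algebraMap_eq, Polynomial.coeff_C_mul, hde,
    Polynomial.coeff_mul_add_eq_of_natDegree_le (Polynomial.natDegree_pow_le_of_le i hp)
      (Polynomial.natDegree_pow_le_of_le (d - i) hq),
    Polynomial.coeff_pow_of_natDegree_le hp, Polynomial.coeff_pow_of_natDegree_le hq]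
  rfl

end

/-- The lift of a rational function to a homogeneous self-map of the plane. -/
noncomputable def lift (φ : RatFunc F) {A : Type*} [CommRing A] [Algebra F A] (p : A × A) : A × A :=
  (homEval φ.num (ratDegree φ) p.1 p.2, homEval φ.denom (ratDegree φ) p.1 p.2)

variable (φ : RatFunc F)

theorem natDegree_num_le : φ.num.natDegree ≤ ratDegree φ := le_max_left _ _

theorem natDegree_denom_le : φ.denom.natDegree ≤ ratDegree φ := le_max_right _ _

section

variable {A B : Type*} [CommRing A] [Algebra F A] [CommRing B] [Algebra F B]

theorem map_lift_iterate (ψ : A →ₐ[F] B) (n : ℕ) (p : A × A) :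
    Prod.map ψ ψ ((lift φ)^[n] p) = (lift φ)^[n] (Prod.map ψ ψ p) := by
  induction n with
  | zero => rfl
  | succ n ih =>
    rw [Function.iterate_succ_apply', Function.iterate_succ_apply', ← ih]
    simp [lift, map_homEval]

theorem lift_iterate_smul (n : ℕ) (c : A) (p : A × A) :
    (lift φ)^[n] (c • p) = c ^ ratDegree φ ^ n • (lift φ)^[n] p := by
  induction n with
  | zero => simp
  | succ n ih =>
    rw [Function.iterate_succ_apply', Function.iterate_succ_apply', ih]
    ext <;> simp [lift, homEval_mul, pow_succ, pow_mul]

end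

theorem natDegree_lift_iterate_le (n : ℕ) {p : F[X] × F[X]} (hp₁ : p.1.natDegree ≤ 1)
    (hp₂ : p.2.natDegree ≤ 1) :
    ((lift φ)^[n] p).1.natDegree ≤ ratDegree φ ^ n ∧
      ((lift φ)^[n] p).2.natDegree ≤ ratDegree φ ^ n := by
  induction n with
  | zero => exact ⟨hp₁, hp₂⟩
  | succ n ih =>
    rw [Function.iterate_succ_apply', pow_succ']
    exact ⟨natDegree_homEval_le _ _ ih.1 ih.2, natDegree_homEval_le _ _ ih.1 ih.2⟩

theorem coeff_lift_iterate (n : ℕ) {p : F[X] × F[X]} (hp₁ : p.1.natDegree ≤ 1)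
    (hp₂ : p.2.natDegree ≤ 1) :
    (((lift φ)^[n] p).1.coeff (ratDegree φ ^ n), ((lift φ)^[n] p).2.coeff (ratDegree φ ^ n)) =
      (lift φ)^[n] (p.1.coeff 1, p.2.coeff 1) := by
  induction n with
  | zero => simp
  | succ n ih =>
    obtain ⟨h₁, h₂⟩ := natDegree_lift_iterate_le φ n hp₁ hp₂
    rw [Function.iterate_succ_apply', Function.iterate_succ_apply', pow_succ', ← ih]
    simp only [lift]
    rw [coeff_homEval _ _ h₁ h₂, coeff_homEval _ _ h₁ h₂]

variable {L : Type u} [Field L]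

open scoped Classical in
/-- The point of the projective line with given homogeneous coordinates. -/
noncomputable def pt (p : L × L) : OnePoint L :=
  if p.2 = 0 then OnePoint.infty else ((p.1 / p.2 : L) : OnePoint L)

theorem pt_of_snd_eq_zero {p : L × L} (h : p.2 = 0) : pt p = OnePoint.infty := if_pos h

theorem pt_of_snd_ne_zero {p : L × L} (h : p.2 ≠ 0) : pt p = ((p.1 / p.2 : L) : OnePoint L) :=
  if_neg h

theorem pt_coords (P : OnePoint L) : pt (coords P) = P := by
  induction P using OnePoint.rec with
  | infty => simp [pt, coords]
  | coe x => simp [pt, coords]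

theorem coords_ne_zero (P : OnePoint L) : coords P ≠ 0 := by
  induction P using OnePoint.rec with
  | infty => simp [coords]
  | coe x => simp [coords]

theorem pt_smul {c : L} (hc : c ≠ 0) (p : L × L) : pt (c • p) = pt p := by
  by_cases h : p.2 = 0
  · simp [pt, h]
  · simp [pt, h, hc, mul_div_mul_left]

theorem eq_smul_of_pt_eq {p q : L × L} (hp : p ≠ 0) (hq : q ≠ 0) (h : pt p = pt q) :
    ∃ c : L, c ≠ 0 ∧ p = c • q := by
  obtain ⟨p₁, p₂⟩ := p
  obtain ⟨q₁, q₂⟩ := q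
  by_cases hp2 : p₂ = 0
  · by_cases hq2 : q₂ = 0
    · subst hp2 hq2
      have hp1 : p₁ ≠ 0 := by rintro rfl; exact hp rfl
      have hq1 : q₁ ≠ 0 := by rintro rfl; exact hq rfl
      exact ⟨p₁ / q₁, div_ne_zero hp1 hq1, by simp [hq1]⟩
    · simp [pt, hp2, hq2] at h
  · by_cases hq2 : q₂ = 0
    · simp [pt, hp2, hq2] at h
    · refine ⟨p₂ / q₂, div_ne_zero hp2 hq2, ?_⟩
      simp only [pt, hp2, hq2, if_false, OnePoint.coe_eq_coe] at h
      rw [div_eq_div_iff hp2 hq2] at h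
      ext
      · simp only [Prod.smul_mk, smul_eq_mul]
        field_simp
        linear_combination h
      · simp [hq2]

variable [Algebra F L]

theorem map_algebraMap_eq_pt (P : OnePoint F) :
    OnePoint.map (algebraMap F L) P =
      pt (Prod.map (algebraMap F L) (algebraMap F L) (coords P)) := by
  induction P using OnePoint.rec with
  | infty => simp [pt, coords]
  | coe x => simp [pt, coords]

theorem aeval_num_ne_zero_or (x : L) :
    Polynomial.aeval x φ.num ≠ 0 ∨ Polynomial.aeval x φ.denom ≠ 0 := by
  by_contra! h
  obtain ⟨a, b, hab⟩ := φ.isCoprime_num_denom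
  have := congrArg (Polynomial.aeval x) hab
  simp [h.1, h.2] at this

theorem lift_ne_zero {p : L × L} (hp : p ≠ 0) : lift φ p ≠ 0 := by
  obtain ⟨x, y⟩ := p
  intro h
  simp only [lift, Prod.mk_eq_zero] at h
  by_cases hy : y = 0
  · subst hy
    have hx : x ≠ 0 := by rintro rfl; exact hp rfl
    simp only [homEval_zero_right, mul_eq_zero, FaithfulSMul.algebraMap_eq_zero_iff,
      pow_eq_zero_iff', hx, false_and, or_false] at h
    rcases le_total φ.num.natDegree φ.denom.natDegree with hle | hle
    · have : ratDegree φ = φ.denom.natDegree := max_eq_right hle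
      rw [this] at h
      exact φ.denom_ne_zero (Polynomial.leadingCoeff_eq_zero.1 h.2)
    · have hd : ratDegree φ = φ.num.natDegree := max_eq_left hle
      rw [hd] at h
      have h0 := Polynomial.leadingCoeff_eq_zero.1 h.1
      rw [h0, Polynomial.natDegree_zero, Nat.le_zero] at hle
      rw [h0, Polynomial.natDegree_zero, ← hle] at h
      exact φ.denom_ne_zero (Polynomial.leadingCoeff_eq_zero.1 h.2)
  · rw [homEval_of_ne_zero _ _ (natDegree_num_le φ) x hy,
      homEval_of_ne_zero _ _ (natDegree_denom_le φ) x hy] at h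
    have hyd := pow_ne_zero (ratDegree φ) hy
    rcases aeval_num_ne_zero_or φ (x / y) with h1 | h1
    · exact mul_ne_zero hyd h1 h.1
    · exact mul_ne_zero hyd h1 h.2

theorem ratMap_pt {p : L × L} (hp : p ≠ 0) : ratMap φ L (pt p) = pt (lift φ p) := by
  obtain ⟨x, y⟩ := p
  by_cases hy : y = 0
  · subst hy
    have hx : x ≠ 0 := by rintro rfl; exact hp rfl
    have hxd := pow_ne_zero (ratDegree φ) hx
    have h1 : pt (x, (0 : L)) = OnePoint.infty := by simp [pt]
    have h2 : (lift φ (x, (0 : L))).2 = algebraMap F L (φ.denom.coeff (ratDegree φ)) *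
      x ^ ratDegree φ := homEval_zero_right _ _ _
    rw [h1, ratMap, OnePoint.elim_infty]
    by_cases hlt : φ.denom.natDegree < φ.num.natDegree
    · have hd : ratDegree φ = φ.num.natDegree := max_eq_left hlt.le
      rw [if_pos hlt, pt_of_snd_eq_zero]
      rw [h2, hd, Polynomial.coeff_eq_zero_of_natDegree_lt hlt, map_zero, zero_mul]
    · have hd : ratDegree φ = φ.denom.natDegree := max_eq_right (not_lt.1 hlt)
      have hlc : algebraMap F L (φ.denom.coeff (ratDegree φ)) ≠ 0 := by
        rw [hd]
        simpa using φ.denom_ne_zero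
      rw [if_neg hlt, pt_of_snd_ne_zero (h2 ▸ mul_ne_zero hlc hxd), h2]
      simp only [lift, homEval_zero_right]
      rw [mul_div_mul_right _ _ hxd, map_div₀, hd]
      rfl
  · have hyd := pow_ne_zero (ratDegree φ) hy
    have h1 : pt (x, y) = ((x / y : L) : OnePoint L) := by simp [pt, hy]
    have h2 : (lift φ (x, y)).2 = y ^ ratDegree φ * Polynomial.aeval (x / y) φ.denom :=
      homEval_of_ne_zero _ _ (natDegree_denom_le φ) x hy
    rw [h1, ratMap, OnePoint.elim_some]
    by_cases h0 : Polynomial.aeval (x / y) φ.denom = 0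
    · rw [if_pos h0, pt_of_snd_eq_zero (by rw [h2, h0, mul_zero])]
    · rw [if_neg h0, pt_of_snd_ne_zero (h2 ▸ mul_ne_zero hyd h0), h2]
      simp only [lift, homEval_of_ne_zero _ _ (natDegree_num_le φ) x hy]
      rw [mul_div_mul_left _ _ hyd]

theorem lift_iterate_ne_zero (n : ℕ) {p : L × L} (hp : p ≠ 0) : (lift φ)^[n] p ≠ 0 := by
  induction n with
  | zero => exact hp
  | succ n ih =>
    rw [Function.iterate_succ_apply']
    exact lift_ne_zero φ ih

theorem ratMap_iterate_pt (n : ℕ) {p : L × L} (hp : p ≠ 0) :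
    (ratMap φ L)^[n] (pt p) = pt ((lift φ)^[n] p) := by
  induction n with
  | zero => rfl
  | succ n ih =>
    rw [Function.iterate_succ_apply', Function.iterate_succ_apply', ih,
      ratMap_pt φ (lift_iterate_ne_zero φ n hp)]

theorem finite_fiber_ratMap (hφ : 2 ≤ ratDegree φ) (Q : OnePoint L) :
    (ratMap φ L ⁻¹' {Q}).Finite := by
  classical
  obtain ⟨⟨c₁, c₂⟩, hc⟩ : ∃ c, coords Q = c := ⟨_, rfl⟩
  have hc0 : (c₁, c₂) ≠ 0 := hc ▸ coords_ne_zero Q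
  set h : L[X] := Polynomial.C c₂ * φ.num.map (algebraMap F L) -
    Polynomial.C c₁ * φ.denom.map (algebraMap F L) with hh
  have hh0 : h ≠ 0 := by
    intro h0
    rw [hh, sub_eq_zero] at h0
    have hden : φ.denom.map (algebraMap F L) ≠ 0 :=
      (Polynomial.map_ne_zero_iff (algebraMap F L).injective).2 φ.denom_ne_zero
    have hcop : IsCoprime (φ.num.map (algebraMap F L)) (φ.denom.map (algebraMap F L)) :=
      φ.isCoprime_num_denom.map (Polynomial.mapRingHom (algebraMap F L))
    by_cases h2 : c₂ = 0
    · subst h2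
      have h1 : c₁ ≠ 0 := by rintro rfl; exact hc0 rfl
      rw [Polynomial.C_0, zero_mul] at h0
      exact mul_ne_zero (Polynomial.C_ne_zero.2 h1) hden h0.symm
    · have hu : IsUnit (φ.denom.map (algebraMap F L)) := by
        refine hcop.isUnit_of_dvd' ?_ dvd_rfl
        have : φ.num.map (algebraMap F L) =
            Polynomial.C (c₂⁻¹ * c₁) * φ.denom.map (algebraMap F L) := by
          rw [Polynomial.C_mul, mul_assoc, ← h0, ← mul_assoc, ← Polynomial.C_mul,
            inv_mul_cancel₀ h2, Polynomial.C_1, one_mul]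
        rw [this]
        exact dvd_mul_left _ _
      have hd1 : φ.denom.natDegree = 0 := by
        rw [← Polynomial.natDegree_map (algebraMap F L)]
        exact Polynomial.natDegree_eq_zero_of_isUnit hu
      have hd2 : φ.num.natDegree = 0 := by
        rw [← Polynomial.natDegree_map (algebraMap F L), ← Polynomial.natDegree_C_mul h2, h0]
        refine Nat.le_zero.1 ((Polynomial.natDegree_C_mul_le _ _).trans ?_)
        rw [Polynomial.natDegree_map, hd1]
      simp [ratDegree, hd1, hd2] at hφ
  refine ((h.rootSet_finite L).image ((↑) : L → OnePoint L) |>.union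
    (Set.finite_singleton OnePoint.infty)).subset ?_
  intro P hP
  induction P using OnePoint.rec with
  | infty => exact Or.inr rfl
  | coe x =>
    refine Or.inl ⟨x, ?_, rfl⟩
    have hx : pt (x, (1 : L)) = (x : OnePoint L) := by simp [pt]
    have hx0 : (x, (1 : L)) ≠ 0 := by simp
    rw [Set.mem_preimage, Set.mem_singleton_iff, ← hx, ratMap_pt φ hx0, ← pt_coords Q, hc] at hP
    obtain ⟨r, -, hr⟩ := eq_smul_of_pt_eq (lift_ne_zero φ hx0) hc0 hP
    simp only [lift, homEval_one_right _ _ (natDegree_num_le φ),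
      homEval_one_right _ _ (natDegree_denom_le φ), Prod.smul_mk, smul_eq_mul,
      Prod.mk.injEq] at hr
    rw [Polynomial.mem_rootSet_of_ne hh0]
    simp only [hh, map_sub, map_mul, Polynomial.aeval_C, Polynomial.aeval_map_algebraMap, hr.1,
      hr.2, Algebra.algebraMap_self, RingHom.id_apply]
    ring

end Lift

/-! ### The polynomial model at a periodic point -/

section Model

variable {F : Type u} [Field F]

/-- The linear automorphism that maps the standard basis to `b`, `c`. -/
def toBasis (b c : F × F) {A : Type*} [CommRing A] [Algebra F A] (p : A × A) : A × A :=
  (algebraMap F A b.1 * p.1 + algebraMap F A c.1 * p.2,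
    algebraMap F A b.2 * p.1 + algebraMap F A c.2 * p.2)

/-- The coordinates with respect to the basis `b`, `c`, up to the determinant of the basis. The
second coordinate vanishes on the line of `b`. -/
def coordsIn (b c : F × F) {A : Type*} [CommRing A] [Algebra F A] (p : A × A) : A × A :=
  (algebraMap F A c.2 * p.1 - algebraMap F A c.1 * p.2,
    algebraMap F A b.1 * p.2 - algebraMap F A b.2 * p.1)

section

variable (b c : F × F) {A B : Type*} [CommRing A] [Algebra F A] [CommRing B] [Algebra F B]

theorem coordsIn_toBasis (p : A × A) :
    coordsIn b c (toBasis b c p) = algebraMap F A (b.1 * c.2 - c.1 * b.2) • p := by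
  ext <;> simp [coordsIn, toBasis] <;> ring

theorem toBasis_coordsIn (p : A × A) :
    toBasis b c (coordsIn b c p) = algebraMap F A (b.1 * c.2 - c.1 * b.2) • p := by
  ext <;> simp [coordsIn, toBasis] <;> ring

theorem coordsIn_smul (r : A) (p : A × A) : coordsIn b c (r • p) = r • coordsIn b c p := by
  ext <;> simp [coordsIn] <;> ring

theorem toBasis_smul (r : A) (p : A × A) : toBasis b c (r • p) = r • toBasis b c p := by
  ext <;> simp [toBasis] <;> ring

theorem map_coordsIn (ψ : A →ₐ[F] B) (p : A × A) :
    Prod.map ψ ψ (coordsIn b c p) = coordsIn b c (Prod.map ψ ψ p) := by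
  ext <;> simp [coordsIn]

theorem map_toBasis (ψ : A →ₐ[F] B) (p : A × A) :
    Prod.map ψ ψ (toBasis b c p) = toBasis b c (Prod.map ψ ψ p) := by
  ext <;> simp [toBasis]

end

variable (φ : RatFunc F) (b c : F × F) (m : ℕ)

/-- Numerator and denominator of the `m`-th iterate of `φ` in the affine coordinate for which `b`
is the point at infinity and `c` is the origin. -/
noncomputable def model : F[X] × F[X] :=
  coordsIn b c ((lift φ)^[m] (toBasis b c (Polynomial.X, 1)))

theorem aeval_model {A : Type*} [CommRing A] [Algebra F A] (t : A) :
    (Polynomial.aeval t (model φ b c m).1, Polynomial.aeval t (model φ b c m).2) =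
      coordsIn b c ((lift φ)^[m] (toBasis b c (t, (1 : A)))) := by
  have h := map_coordsIn b c (Polynomial.aeval (R := F) t)
    ((lift φ)^[m] (toBasis b c (Polynomial.X, 1)))
  rw [map_lift_iterate, map_toBasis] at h
  simpa [model, Prod.map] using h

variable {L : Type u} [Field L] [Algebra F L]

/-- If `p` does not represent `b`, then the values of the model at the affine coordinate of `p` are
homogeneous coordinates of the image of `p`. -/
theorem exists_aeval_model_eq (hdet : b.1 * c.2 - c.1 * b.2 ≠ 0) {p : L × L}
    (hp : (coordsIn b c p).2 ≠ 0) :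
    ∃ r : L, r ≠ 0 ∧
      (Polynomial.aeval ((coordsIn b c p).1 / (coordsIn b c p).2) (model φ b c m).1,
        Polynomial.aeval ((coordsIn b c p).1 / (coordsIn b c p).2) (model φ b c m).2) =
        r • coordsIn b c ((lift φ)^[m] p) := by
  set s := (coordsIn b c p).2 with hs
  have hdetL : algebraMap F L (b.1 * c.2 - c.1 * b.2) ≠ 0 :=
    (map_ne_zero _).2 hdet
  have h1 : ((coordsIn b c p).1 / s, (1 : L)) = s⁻¹ • coordsIn b c p := by
    ext
    · simp [div_eq_inv_mul]
    · simp [← hs, hp]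
  refine ⟨(s⁻¹ * algebraMap F L (b.1 * c.2 - c.1 * b.2)) ^ ratDegree φ ^ m, by positivity, ?_⟩
  rw [aeval_model, h1, toBasis_smul, toBasis_coordsIn, smul_smul, lift_iterate_smul,
    coordsIn_smul]

theorem pt_eq_of_coordsIn_snd_eq_zero (hdet : b.1 * c.2 - c.1 * b.2 ≠ 0) {p : L × L} (hp : p ≠ 0)
    (h : (coordsIn b c p).2 = 0) :
    pt p = pt (Prod.map (algebraMap F L) (algebraMap F L) b) := by
  have hdetL : algebraMap F L (b.1 * c.2 - c.1 * b.2) ≠ 0 :=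
    (map_ne_zero _).2 hdet
  have h1 : algebraMap F L (b.1 * c.2 - c.1 * b.2) • p =
      (coordsIn b c p).1 • Prod.map (algebraMap F L) (algebraMap F L) b := by
    rw [← toBasis_coordsIn]
    ext
    · simp [toBasis, h, mul_comm]
    · simp [toBasis, h, mul_comm]
  have h2 : (coordsIn b c p).1 ≠ 0 := by
    intro h0
    rw [h0, zero_smul] at h1
    exact smul_ne_zero hdetL hp h1
  rw [← pt_smul hdetL, h1, pt_smul h2]

theorem isCoprime_model (hdet : b.1 * c.2 - c.1 * b.2 ≠ 0) :
    IsCoprime (model φ b c m).1 (model φ b c m).2 := by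
  rw [Polynomial.isCoprime_iff_aeval_ne_zero_of_isAlgClosed F (AlgebraicClosure F)]
  intro t
  by_contra! h
  have hdetL : algebraMap F (AlgebraicClosure F) (b.1 * c.2 - c.1 * b.2) ≠ 0 :=
    (map_ne_zero _).2 hdet
  have h0 : toBasis b c (t, (1 : AlgebraicClosure F)) ≠ 0 := by
    intro h0
    have h1 := coordsIn_toBasis b c (t, (1 : AlgebraicClosure F))
    rw [h0] at h1
    have h2 := congrArg Prod.snd h1
    simp only [coordsIn, Prod.fst_zero, Prod.snd_zero, mul_zero, sub_zero, Prod.smul_mk,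
      smul_eq_mul, mul_one] at h2
    exact hdetL h2.symm
  have h1 := aeval_model φ b c m t
  rw [h.1, h.2] at h1
  refine lift_iterate_ne_zero φ m h0 ?_
  have h2 := toBasis_coordsIn b c ((lift φ)^[m] (toBasis b c (t, (1 : AlgebraicClosure F))))
  rw [← h1] at h2
  refine (smul_eq_zero.1 (h2.symm.trans ?_)).resolve_left hdetL
  ext <;> simp [toBasis]

/-- If `b` is fixed, then infinity is fixed in the model: the numerator has full degree, and the
denominator has a smaller one. -/
theorem natDegree_model (hφ : 0 < ratDegree φ) (hdet : b.1 * c.2 - c.1 * b.2 ≠ 0) {r : F}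
    (hr : r ≠ 0) (hb : (lift φ)^[m] b = r • b) :
    (model φ b c m).1.natDegree = ratDegree φ ^ m ∧
      (model φ b c m).2.natDegree < ratDegree φ ^ m := by
  set q : F[X] × F[X] := toBasis b c (Polynomial.X, 1) with hq
  have hq1 : q.1.natDegree ≤ 1 ∧ q.2.natDegree ≤ 1 := by
    constructor
    · simp only [hq, toBasis, Polynomial.algebraMap_eq]
      compute_degree
    · simp only [hq, toBasis, Polynomial.algebraMap_eq]
      compute_degree
  have hq2 : (q.1.coeff 1, q.2.coeff 1) = b := by
    ext <;> simp [hq, toBasis]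
  obtain ⟨hd1, hd2⟩ := natDegree_lift_iterate_le φ m hq1.1 hq1.2
  have hco := coeff_lift_iterate φ m hq1.1 hq1.2
  rw [hq2, hb] at hco
  have hco1 := congrArg Prod.fst hco
  have hco2 := congrArg Prod.snd hco
  simp only [Prod.smul_fst, Prod.smul_snd, smul_eq_mul] at hco1 hco2
  have hle : ∀ x y : F, (Polynomial.C x * ((lift φ)^[m] q).1 -
      Polynomial.C y * ((lift φ)^[m] q).2).natDegree ≤ ratDegree φ ^ m := fun x y =>
    (Polynomial.natDegree_sub_le_of_le ((Polynomial.natDegree_C_mul_le _ _).trans hd1)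
      ((Polynomial.natDegree_C_mul_le _ _).trans hd2)).trans (max_self _).le
  have hle' : ∀ x y : F, (Polynomial.C x * ((lift φ)^[m] q).2 -
      Polynomial.C y * ((lift φ)^[m] q).1).natDegree ≤ ratDegree φ ^ m := fun x y =>
    (Polynomial.natDegree_sub_le_of_le ((Polynomial.natDegree_C_mul_le _ _).trans hd2)
      ((Polynomial.natDegree_C_mul_le _ _).trans hd1)).trans (max_self _).le
  have h1 : (model φ b c m).1.coeff (ratDegree φ ^ m) = r * (b.1 * c.2 - c.1 * b.2) := by
    simp only [model, coordsIn, ← hq, Polynomial.algebraMap_eq, Polynomial.coeff_sub,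
      Polynomial.coeff_C_mul, hco1, hco2]
    ring
  have h2 : (model φ b c m).2.coeff (ratDegree φ ^ m) = 0 := by
    simp only [model, coordsIn, ← hq, Polynomial.algebraMap_eq, Polynomial.coeff_sub,
      Polynomial.coeff_C_mul, hco1, hco2]
    ring
  refine ⟨le_antisymm (hle _ _) (Polynomial.le_natDegree_of_ne_zero ?_), ?_⟩
  · rw [h1]
    exact mul_ne_zero hr hdet
  · refine lt_of_le_of_ne (hle' _ _) fun heq => ?_
    have hpos : 0 < ratDegree φ ^ m := by positivity
    have heq' : (model φ b c m).2.natDegree = ratDegree φ ^ m := heq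
    rw [← heq', Polynomial.coeff_natDegree, Polynomial.leadingCoeff_eq_zero] at h2
    rw [h2, Polynomial.natDegree_zero] at heq'
    omega

variable {φ m}

/-- If `β` is the only point that is mapped to `β` by the `m`-th iterate, then `β` is
exceptional. -/
theorem isExceptional_of_unique_preimage (hφ : 2 ≤ ratDegree φ) {β : OnePoint F} (hm : 1 ≤ m)
    (h : ∀ Q : OnePoint (AlgebraicClosure F), (ratMap φ (AlgebraicClosure F))^[m] Q =
      OnePoint.map (algebraMap F (AlgebraicClosure F)) β →
        Q = OnePoint.map (algebraMap F (AlgebraicClosure F)) β) : IsExceptional φ β := by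
  set β' := OnePoint.map (algebraMap F (AlgebraicClosure F)) β
  have hfib : ∀ r : ℕ, ((ratMap φ (AlgebraicClosure F))^[r] ⁻¹' {β'}).Finite := by
    intro r
    induction r with
    | zero => simp
    | succ r ih =>
      rw [Function.iterate_succ, Set.preimage_comp]
      exact ih.preimage' fun Q _ => finite_fiber_ratMap φ hφ Q
  have hk : ∀ (k : ℕ) (Q : OnePoint (AlgebraicClosure F)),
      (ratMap φ (AlgebraicClosure F))^[m * k] Q = β' → Q = β' := by
    intro k
    induction k with
    | zero => exact fun Q hQ => hQ
    | succ k ih =>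
      intro Q hQ
      rw [Nat.mul_succ, Function.iterate_add_apply] at hQ
      exact h Q (ih _ hQ)
  refine ((Set.finite_lt_nat m).biUnion fun r _ => hfib r).subset ?_
  rintro Q ⟨n, -, hn⟩
  refine Set.mem_biUnion (x := n % m) (Nat.mod_lt _ hm) ?_
  rw [← Nat.div_add_mod n m, Function.iterate_add_apply] at hn
  exact hk _ _ hn

theorem natDegree_model_snd_pos (hφ : 2 ≤ ratDegree φ) (hm : 1 ≤ m)
    (hdet : b.1 * c.2 - c.1 * b.2 ≠ 0) {β : OnePoint F} (hb : coords β = b) {r : F}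
    (hr : r ≠ 0) (hfix : (lift φ)^[m] b = r • b) (hexc : ¬ IsExceptional φ β) :
    0 < (model φ b c m).2.natDegree := by
  rw [Nat.pos_iff_ne_zero]
  intro h0
  refine hexc (isExceptional_of_unique_preimage hφ hm fun Q hQ => ?_)
  obtain ⟨hd1, hd2⟩ := natDegree_model φ b c m (by omega) hdet hr hfix
  have hg := Polynomial.eq_C_of_natDegree_eq_zero h0
  have hg0 : (model φ b c m).2.coeff 0 ≠ 0 := by
    intro hz
    have hcop := isCoprime_model φ b c m hdet
    rw [hg, hz, Polynomial.C_0, isCoprime_zero_right] at hcop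
    have := Polynomial.natDegree_eq_zero_of_isUnit hcop
    have hpos : 0 < ratDegree φ ^ m := by positivity
    omega
  have hq := coords_ne_zero Q
  rw [map_algebraMap_eq_pt, hb] at hQ ⊢
  rw [← pt_coords Q] at hQ ⊢
  refine pt_eq_of_coordsIn_snd_eq_zero b c hdet hq ?_
  by_contra hne
  have hb0 : Prod.map (algebraMap F (AlgebraicClosure F)) (algebraMap F (AlgebraicClosure F)) b
      ≠ 0 := by
    intro h
    have hb1 : b = 0 := by
      have h1 := congrArg Prod.fst h
      have h2 := congrArg Prod.snd h
      ext
      · simpa using h1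
      · simpa using h2
    rw [hb1] at hdet
    simp at hdet
  obtain ⟨s, -, hs⟩ := exists_aeval_model_eq φ b c m hdet hne
  rw [ratMap_iterate_pt φ m hq] at hQ
  obtain ⟨s', -, hs'⟩ := eq_smul_of_pt_eq (lift_iterate_ne_zero φ m hq) hb0 hQ
  have h2 := congrArg Prod.snd hs
  rw [hs', coordsIn_smul] at h2
  rw [hg, Polynomial.aeval_C] at h2
  refine hg0 ((algebraMap F (AlgebraicClosure F)).injective ?_)
  refine h2.trans ?_
  simp only [coordsIn, Prod.map_fst, Prod.map_snd, Prod.smul_snd, smul_eq_mul, map_zero]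
  ring

/-- The reduction to polynomials: after a change of coordinates that moves `β` to infinity, with
new coordinate `ζ`, the `m`-th iterate of `φ` becomes `x ↦ f(x) / g(x)`, where infinity is fixed
but not totally ramified. -/
theorem exists_polynomial_model (hφ : 2 ≤ ratDegree φ) (hm : 1 ≤ m) {β : OnePoint F}
    (hper : (ratMap φ F)^[m] β = β) (hexc : ¬ IsExceptional φ β) :
    ∃ (f g : F[X]) (ζ : OnePoint F → F), IsCoprime f g ∧ g.natDegree < f.natDegree ∧
      0 < g.natDegree ∧ (∀ P Q, P ≠ β → Q ≠ β → ζ P = ζ Q → P = Q) ∧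
      (∀ P, P ≠ β → (ratMap φ F)^[m] P ≠ β → g.eval (ζ P) ≠ 0 ∧
        g.eval (ζ P) * ζ ((ratMap φ F)^[m] P) = f.eval (ζ P)) ∧
      ∀ (v : AbsoluteValue F ℝ) P, chordal v P β = 1 → v (ζ P) ≤ 1 := by
  obtain ⟨b, hb⟩ : ∃ b, coords β = b := ⟨_, rfl⟩
  -- complete `b` to a basis by a standard basis vector
  obtain ⟨c, hdet, hc⟩ : ∃ c : F × F, b.1 * c.2 - c.1 * b.2 ≠ 0 ∧
      (c = (1, 0) ∨ c = (0, 1)) := by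
    by_cases h : b.2 = 0
    · refine ⟨(0, 1), ?_, Or.inr rfl⟩
      have hb0 : b ≠ 0 := hb ▸ coords_ne_zero β
      simp only [mul_one, zero_mul, sub_zero]
      exact fun h1 => hb0 (Prod.ext h1 h)
    · exact ⟨(1, 0), by simpa using h, Or.inl rfl⟩
  have hβ : pt b = β := hb ▸ pt_coords β
  have hb0 : b ≠ 0 := hb ▸ coords_ne_zero β
  obtain ⟨r, hr, hfix⟩ : ∃ r : F, r ≠ 0 ∧ (lift φ)^[m] b = r • b := by
    refine eq_smul_of_pt_eq (lift_iterate_ne_zero φ m hb0) hb0 ?_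
    rw [← ratMap_iterate_pt φ m hb0, hβ, hper]
  have hne : ∀ P, P ≠ β → (coordsIn b c (coords P)).2 ≠ 0 := by
    intro P hP h0
    refine hP ?_
    rw [← pt_coords P, ← hβ]
    simpa using pt_eq_of_coordsIn_snd_eq_zero b c hdet (coords_ne_zero P) h0
  obtain ⟨hd1, hd2⟩ := natDegree_model φ b c m (by omega) hdet hr hfix
  refine ⟨(model φ b c m).1, (model φ b c m).2,
    fun P => (coordsIn b c (coords P)).1 / (coordsIn b c (coords P)).2,
    isCoprime_model φ b c m hdet, by rw [hd1]; exact hd2,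
    natDegree_model_snd_pos b c hφ hm hdet hb hr hfix hexc, ?_, ?_, ?_⟩
  · intro P Q hP hQ h
    have hP2 := hne P hP
    have hQ2 := hne Q hQ
    simp only at h
    have hscale : ∀ p : F × F, (coordsIn b c p).2 ≠ 0 →
        pt p = pt (toBasis b c ((coordsIn b c p).1 / (coordsIn b c p).2, (1 : F))) := by
      intro p hp
      have h1 : ((coordsIn b c p).1 / (coordsIn b c p).2, (1 : F)) =
          ((coordsIn b c p).2)⁻¹ • coordsIn b c p := by
        ext
        · simp [div_eq_inv_mul]
        · simp [hp]
      rw [h1, toBasis_smul, toBasis_coordsIn, smul_smul]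
      exact (pt_smul (mul_ne_zero (inv_ne_zero hp) hdet) p).symm
    rw [← pt_coords P, ← pt_coords Q, hscale _ hP2, hscale _ hQ2, h]
  · intro P hP hP'
    obtain ⟨s, hs, hs'⟩ := exists_aeval_model_eq φ b c m hdet (hne P hP)
    have hlift : pt (coords ((ratMap φ F)^[m] P)) = pt ((lift φ)^[m] (coords P)) := by
      rw [pt_coords, ← ratMap_iterate_pt φ m (coords_ne_zero P), pt_coords]
    obtain ⟨s₁, hs₁, hs₁'⟩ := eq_smul_of_pt_eq (coords_ne_zero _)
      (lift_iterate_ne_zero φ m (coords_ne_zero P)) hlift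
    have h2 := hne _ hP'
    dsimp only
    rw [hs₁', coordsIn_smul] at h2 ⊢
    simp only [Polynomial.coe_aeval_eq_eval, Prod.smul_fst, Prod.smul_snd, smul_eq_mul,
      Prod.ext_iff] at hs' h2 ⊢
    have h3 := right_ne_zero_of_mul h2
    rw [hs'.1, hs'.2]
    exact ⟨mul_ne_zero hs h3, by field_simp⟩
  · intro v P hP
    have hmaxP : 0 < max (v (coords P).1) (v (coords P).2) := by
      rcases eq_or_ne (coords P).1 0 with h | h
      · refine lt_max_of_lt_right (v.pos fun h' => coords_ne_zero P (Prod.ext h h'))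
      · exact lt_max_of_lt_left (v.pos h)
    have hmaxb : 1 ≤ max (v b.1) (v b.2) := by
      rw [← hb]
      induction β using OnePoint.rec with
      | infty => simp [coords]
      | coe x => simp [coords]
    rw [chordal, hb, div_eq_one_iff_eq (by positivity)] at hP
    have h2 : v (coordsIn b c (coords P)).2 =
        max (v (coords P).1) (v (coords P).2) * max (v b.1) (v b.2) := by
      rw [← hP, ← v.map_neg]
      congr 1
      simp [coordsIn]
      ring
    have h1 : v (coordsIn b c (coords P)).1 ≤ max (v (coords P).1) (v (coords P).2) := by
      rcases hc with rfl | rfl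
      · simp [coordsIn]
      · simp [coordsIn]
    rw [map_div₀, div_le_one (by rw [h2]; positivity), h2]
    exact h1.trans (le_mul_of_one_le_right hmaxP.le hmaxb)

end Model

/-! ### Global fields -/

theorem iterate_injective_of_infinite_range {X : Type*} (h : X → X) (x : X)
    (hinf : (Set.range fun n => h^[n] x).Infinite) : Function.Injective fun n => h^[n] x := by
  have key : ∀ a b, a < b → h^[a] x ≠ h^[b] x := by
    intro a b hab heq
    refine hinf (((Set.finite_lt_nat b).image fun n => h^[n] x).subset ?_)
    rintro _ ⟨n, rfl⟩
    induction n using Nat.strong_induction_on with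
    | _ n ih =>
      rcases lt_or_ge n b with hn | hn
      · exact ⟨n, hn, rfl⟩
      · have h1 : h^[n] x = h^[n - b + a] x := by
          rw [Function.iterate_add_apply, heq, ← Function.iterate_add_apply, Nat.sub_add_cancel hn]
        simp only [h1]
        exact ih _ (by omega)
  intro a b hab
  rcases lt_trichotomy a b with h1 | h1 | h1
  · exact absurd hab (key a b h1)
  · exact h1
  · exact absurd hab.symm (key b a h1)

/-- The finiteness statement for an extension `F` of a field `K` with a place system, given an
embedding `ψ` of `F` into a finite separable extension `E` of `K` that acts on `K` as a power
map. -/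
theorem finite_integral_of_placeSystem {K : Type} [Field K] (P : PlaceSystem K) {F E : Type u}
    [Field F] [Algebra K F] [Field E] [Algebra K E] [FiniteDimensional K E]
    [Algebra.IsSeparable K E] (ψ : F →+* E) (q : ℕ) (hq : q ≠ 0)
    (hψ : ∀ a : K, ψ (algebraMap K F a) = algebraMap K E (a ^ q))
    (S : Finset (Place F)) (φ : RatFunc F) (hφ : 2 ≤ ratDegree φ) (α β : OnePoint F)
    (hper : IsPeriodic φ β) (hexc : ¬ IsExceptional φ β) :
    {Q | Q ∈ forwardOrbit φ α ∧ IsSIntegralTo S Q β}.Finite := by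
  classical
  let absF : ∀ i, (E →ₐ[K] (P.ext i).carrier) → AbsoluteValue F ℝ := fun i σ =>
    (P.embAbs i σ).comp (f := ψ) ψ.injective
  have habsF : ∀ i σ a, absF i σ (algebraMap K F a) = P.abs i a ^ q := by
    intro i σ a
    change P.embAbs i σ (ψ (algebraMap K F a)) = _
    rw [hψ, P.embAbs_algebraMap, map_pow]
  have hnontriv : ∀ i ≠ P.infty, ∀ σ, (absF i σ).IsNontrivial := by
    intro i hi σ
    obtain ⟨a, ha, ha1, -⟩ := P.exists_uniformizer i hi
    refine ⟨algebraMap K F a, (map_ne_zero _).2 ha, ?_⟩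
    rw [habsF]
    exact (pow_lt_one₀ ((P.abs i).nonneg a) ha1 hq).ne
  -- only finitely many of the places of `K` lie below a place in `S`
  let bad : Set P.ι := {i | i ≠ P.infty ∧ ∃ σ hv, Place.mk (absF i σ) hv ∈ S}
  have hbad : bad.Finite := by
    choose σ hv hσ using fun i : bad => i.2.2
    have hinj : Function.Injective
        fun i : bad => (⟨Place.mk (absF i (σ i)) (hv i), hσ i⟩ : S) := by
      intro i j hij
      by_contra hne
      have h1 : (absF i (σ i)).IsEquiv (absF j (σ j)) := Quotient.exact (Subtype.ext_iff.1 hij)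
      obtain ⟨a, ha, ha1, ha2⟩ := P.exists_uniformizer i i.2.1
      have h2 := h1.eq_one_iff (x := algebraMap K F a)
      rw [habsF, habsF, ha2 j j.2.1 (fun h => hne (Subtype.ext h.symm)), one_pow] at h2
      exact (pow_lt_one₀ ((P.abs i).nonneg a) ha1 hq).ne (h2.2 rfl)
    exact Set.finite_coe_iff.1 (Finite.of_injective _ hinj)
  obtain ⟨m, hm, hmβ⟩ := hper
  obtain ⟨f, g, ζ, hfg, hdeg, hg, hζ, hstep, hint⟩ := exists_polynomial_model hφ hm hmβ hexc
  by_contra hinf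
  have hinf : {Q | Q ∈ forwardOrbit φ α ∧ IsSIntegralTo S Q β}.Infinite := hinf
  have hinj : Function.Injective fun n => (ratMap φ F)^[n] α := by
    refine iterate_injective_of_infinite_range _ _ (hinf.mono ?_)
    rintro _ ⟨⟨n, rfl⟩, -⟩
    exact ⟨n, rfl⟩
  -- pass to a residue class of exponents modulo the period
  obtain ⟨r, hr⟩ : ∃ r, {k | IsSIntegralTo S ((ratMap φ F)^[m * k + r] α) β}.Infinite := by
    by_contra! hcon
    refine hinf ((((Set.finite_lt_nat m).biUnion fun r _ =>
      (hcon r).image fun k => (ratMap φ F)^[m * k + r] α)).subset ?_)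
    rintro _ ⟨⟨n, rfl⟩, hn⟩
    refine Set.mem_biUnion (x := n % m) (Nat.mod_lt _ hm) ⟨n / m, ?_, ?_⟩
    · change IsSIntegralTo S _ _
      rwa [Nat.div_add_mod]
    · simp only [Nat.div_add_mod]
  let Q : ℕ → OnePoint F := fun k => (ratMap φ F)^[m * k + r] α
  have hQinj : Function.Injective Q := by
    intro k l hkl
    have := hinj hkl
    simpa [Nat.pos_iff_ne_zero.1 hm] using this
  have hQ : ∀ k, (ratMap φ F)^[m] (Q k) = Q (k + 1) := by
    intro k
    simp only [Q]
    rw [← Function.iterate_add_apply]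
    exact congrArg (fun n => (ratMap φ F)^[n] α) (by ring)
  have hQβ : ∀ k, Q k ≠ β := by
    intro k hk
    have h1 := hQ k
    rw [hk, hmβ, ← hk] at h1
    exact absurd (hQinj h1) (by omega)
  have hstep' : ∀ k, g.eval (ζ (Q k)) ≠ 0 ∧
      g.eval (ζ (Q k)) * ζ (Q (k + 1)) = f.eval (ζ (Q k)) := by
    intro k
    have := hstep (Q k) (hQβ k) (by rw [hQ]; exact hQβ _)
    rwa [hQ] at this
  refine P.not_infinitely_often_integral (f.map ψ) (g.map ψ)
    (hfg.map (Polynomial.mapRingHom ψ)) (by simpa using hdeg) (by simpa using hg)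
    (fun k => ψ (ζ (Q k))) (fun k l hkl => ?_) (fun k => ?_) (fun k => ?_)
    (hbad.toFinset ∪ {P.infty}) fun N => ?_
  · exact hQinj (hζ _ _ (hQβ k) (hQβ l) (ψ.injective hkl))
  · rw [Polynomial.eval_map_apply]
    exact (map_ne_zero _).2 (hstep' k).1
  · rw [Polynomial.eval_map_apply, Polynomial.eval_map_apply, ← map_mul, (hstep' k).2]
  · obtain ⟨k, hk, hkN⟩ := hr.exists_gt N
    refine ⟨k, hkN.le, fun i hi σ => ?_⟩
    simp only [Finset.mem_union, Set.Finite.mem_toFinset, Finset.mem_singleton, not_or] at hi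
    refine hint (absF i σ) (Q k) (hk _ (hnontriv i hi.2 σ) fun hS => hi.1 ?_)
    exact ⟨hi.2, σ, _, hS⟩

/-- A finite extension of `K` embeds into its separable closure over `K` by a power of the Frobenius
endomorphism. -/
theorem exists_frobenius_to_separable (K : Type) (F : Type u) [Field K] [Field F] [Algebra K F]
    [FiniteDimensional K F] :
    ∃ (ψ : F →+* separableClosure K F) (q : ℕ), q ≠ 0 ∧
      ∀ a : K, ψ (algebraMap K F a) = algebraMap K (separableClosure K F) (a ^ q) := by
  obtain ⟨p, hp⟩ := ExpChar.exists K
  have : ExpChar (separableClosure K F) p :=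
    expChar_of_injective_algebraMap (algebraMap K (separableClosure K F)).injective p
  refine ⟨IsPurelyInseparable.iterateFrobenius (separableClosure K F) F p le_rfl,
    p ^ IsPurelyInseparable.exponent (separableClosure K F) F, pow_ne_zero _ (expChar_pos K p).ne',
    fun a => ?_⟩
  refine (algebraMap (separableClosure K F) F).injective ?_
  rw [IsPurelyInseparable.algebraMap_iterateFrobenius, map_pow, map_pow]
  rfl

end ArithDyn

theorem mainTheorem3 {F : Type*} [Field F] (hF : ArithDyn.IsGlobalField F)
    (S : Finset (ArithDyn.Place F)) (hS : ∀ w : ArithDyn.Place F, w.IsInfinite → w ∈ S)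
    (φ : RatFunc F) (hφ : 2 ≤ ArithDyn.ratDegree φ) (α β : OnePoint F)
    (hper : ArithDyn.IsPeriodic φ β) (hexc : ¬ ArithDyn.IsExceptional φ β) :
    {P | P ∈ ArithDyn.forwardOrbit φ α ∧ ArithDyn.IsSIntegralTo S P β}.Finite := by
  rcases hF with h | ⟨p, hp, halg, hfin⟩
  · obtain ⟨P⟩ := ArithDyn.nonempty_placeSystem_rat
    exact ArithDyn.finite_integral_of_placeSystem P (E := F) (RingHom.id F) 1 one_ne_zero
      (fun a => by simp) S φ hφ α β hper hexc
  · obtain ⟨P⟩ := ArithDyn.nonempty_placeSystem_ratFunc (ZMod p)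
    obtain ⟨ψ, q, hq, hψ⟩ := ArithDyn.exists_frobenius_to_separable (RatFunc (ZMod p)) F
    exact ArithDyn.finite_integral_of_placeSystem P ψ q hq hψ S φ hφ α β hper hexc
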